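/- **Theorem (Correctness of Adaptive-IB-uPRE).** *Notation.* For $\Lambda\subseteq\mathbb Z^N$ a lattice or a coset of one, $D_{\Lambda,s}$ is the discrete Gaussian distribution, with probabilities proportional to $\exp(-\pi\|x\|^2/s^2)$ for $x\in\Lambda$; $D_{\mathbb Z,0}$ is the point mass at $0$. For $A\in\mathbb Z_q^{n\times m}$ and $u\in\mathbb Z_q^n$ let $\Lambda_u^{\perp}(A)=\{z\in\mathbb Z^m: Az=u \bmod q\}$. Let $k=\lceil\log_2 q\rceil$ and let $G=I_n\otimes(1,2,\dots,2^{k-1})\in\mathbb Z_q^{n\times nk}$ be the gadget matrix. For $c\in\mathbb Z_q^m$ let $BD(c)\in\{0,1\}^{mk}$ be the vector of the $k$ bits of each coordinate (represented in $\{0,\dots,q-1\}$), and for $x\in\mathbb Z^m$ let $P2(x)\in\mathbb Z_q^{mk}$ consist of $x,2x,\dots,2^{k-1}x$ modulo $q$, so that $BD(c)^tP2(x)=c^tx$. *Scheme.* Let $n$ be the security parameter, $m=\bar m+nk$; identities are $id=(b_1,\dots,b_l)\in\{-1,1\}^l$ and messages are bits. * SetUp: choose $\bar A\in\mathbb Z_q^{n\times\bar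 m}$ and $u_0,\dots,u_l\in\mathbb Z_q^n$ uniformly, $R_1,\dots,R_l\leftarrow D_{\mathbb Z,r}^{\bar m\times nk}$, and put $\bar A_j=-\bar AR_j$. The public parameters are $(\bar A,\bar A_1,\dots,\bar A_l,u_0,\dots,u_l)$ and the master key is $(R_1,\dots,R_l)$. For an identity put $A_{id}=[\bar A\mid\sum_j b_j\bar A_j+G]$ and $u_{id}=u_0+\sum_j b_ju_j$. * Extract: the key of $id$ is $x_{id}\leftarrow D_{\Lambda^\perp_{u_{id}}(A_{id}),s}$. * Enc of $b$ under $id$: choose $\mathbf s\in\mathbb Z_q^n$ uniformly, $e\leftarrow D_{\mathbb Z,\alpha q}$, $e_0\leftarrow D_{\mathbb Z,\alpha q}^{\bar m}$, $e_1\leftarrow D_{\mathbb Z,s'}^{nk}$ with $s'^2=(\|e_0\|^2+\bar m(\alpha q)^2)r^2$; output $c_1=A_{id}^t\mathbf s+(e_0,e_1)$, $c_2=u_{id}^t\mathbf s+e+b\lfloor q/2\rfloor$ modulo $q$. * Dec with $x_{id}$: output $0$ if $c_2-x_{id}^tc_1$ is closer to $0$ than to $\lfloor q/2\rfloor$ modulo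 $q$, and $1$ otherwise. * ReKeyGen from $id_i$ to $id_j$: choose $r_1\leftarrow D_{\mathbb Z,r}^{mk\times n}$, $r_2\leftarrow D_{\mathbb Z,r}^{mk}$; output $rk=\begin{pmatrix} r_1A_{id_j}& r_1u_{id_j}+r_2-P2(x_{id_i})\\ 0&1\end{pmatrix}$ modulo $q$. * ReEnc: $(\bar c_1^t\mid\bar c_2)=(BD(c_1)^t\mid c_2)\cdot rk$. *Parameters.* Let $q,\bar m,l$ be functions of $n$ with values in the non-negative integers and $r,s,\alpha$ functions of $n$ with positive real values such that, as $n\to\infty$: $r=\omega(\sqrt{\log n})$ and $r=o(\sqrt n)$; every $q(n)$ is a prime power, $q$ is bounded by a polynomial in $n$ and is large enough that $(nk)^{3/2}r=O(q)$; $\bar m=O(nk)$, and $(\bar A,\bar AR)$, for uniform $\bar A\in\mathbb Z_q^{n\times\bar m}$ and $R\leftarrow D_{\mathbb Z,r}^{\bar m\times nk}$, has negligible statistical distance from the uniform distribution; $s=O(\sqrt{nk})\cdot r^2$; and $1/\alpha$ is of order at least $(nk)^2r^2$, that is, $(nk)^2r^2=O(1/\alpha)$. *Claim.* The scheme is correct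 with overwhelming probability. That is, there is a negligible function $\varepsilon$ such that for every $n$, all identities $id,id_i,id_j\in\{-1,1\}^{l}$ and every bit $b$, with all algorithms run on independent randomness: 1. $\mathrm{Dec}(x_{id},\mathrm{Enc}(id,b))=b$ with probability at least $1-\varepsilon(n)$; 2. $\mathrm{Dec}(x_{id_j},\mathrm{ReEnc}(rk_{i\to j},\mathrm{Enc}(id_i,b)))=b$ with probability at least $1-\varepsilon(n)$, where $rk_{i\to j}$ is generated from $x_{id_i}$, $id_i$, $id_j$. -/

import Mathlib

open Filter Asymptotics

noncomputable section

/-! ### Discrete Gaussians and statistical distance -/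

/-- The Gaussian weight `ρ_s(x) = exp (-π ‖x‖² / s²)` (Euclidean norm), cut down to `Λ`. -/
def gaussWeight {ι : Type} [Fintype ι] (Λ : Set (ι → ℤ)) (s : ℝ) (x : ι → ℤ) : ENNReal :=
  Λ.indicator (fun x => ENNReal.ofReal (Real.exp (-Real.pi * (∑ i, (x i : ℝ) ^ 2) / s ^ 2))) x

open Classical in
/-- The discrete Gaussian `D_{Λ, s}` on a set `Λ` of integer vectors (a lattice or a coset of one):
`x ∈ Λ` has probability `ρ_s(x) / ρ_s(Λ)`. The quotient makes sense whenever `Λ ≠ ∅` and `s ≠ 0`;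
otherwise the value is the point mass at `0` (for `s = 0` and `Λ = ℤ^ι` this is the limit `s → 0`).
For `Λ = ℤ^ι` this is the product distribution `D_{ℤ, s}^ι`. -/
def discreteGaussian {ι : Type} [Fintype ι] (Λ : Set (ι → ℤ)) (s : ℝ) : PMF (ι → ℤ) :=
  if h : (∑' x, gaussWeight Λ s x) ≠ 0 ∧ (∑' x, gaussWeight Λ s x) ≠ ⊤ then
    PMF.normalize (gaussWeight Λ s) h.1 h.2
  else PMF.pure 0

/-- `D_{ℤ, s}`. -/
def gaussInt (s : ℝ) : PMF ℤ :=
  (discreteGaussian (Set.univ : Set (Unit → ℤ)) s).map (fun z => z ())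

/-- `D_{ℤ, s}^ι`: vectors with independent entries from `D_{ℤ, s}`. -/
def gaussVec (ι : Type) [Fintype ι] (s : ℝ) : PMF (ι → ℤ) :=
  discreteGaussian Set.univ s

/-- `D_{ℤ, s}^{ι × κ}`: matrices with independent entries from `D_{ℤ, s}`. -/
def gaussMat (ι κ : Type) [Fintype ι] [Fintype κ] (s : ℝ) : PMF (Matrix ι κ ℤ) :=
  (gaussVec (ι × κ) s).map (fun z => Matrix.of fun i j => z (i, j))

/-- Statistical distance of two distributions. -/
def statDist {Ω : Type} (P Q : PMF Ω) : ℝ :=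
  (1 / 2) * ∑' w, |(P w).toReal - (Q w).toReal|

/-- `ε` is negligible: it decays faster than every inverse polynomial. -/
def Negligible (ε : ℕ → ℝ) : Prop :=
  SuperpolynomialDecay atTop (fun n : ℕ => (n : ℝ)) ε

/-! ### Identity-based unidirectional proxy re-encryption -/

/-- The algorithms of an identity-based unidirectional proxy re-encryption scheme, for one value
of the security parameter. `none` is the error symbol `⊥`. -/
structure IBuPRE (PP MSK ID SK RK CT M : Type) where
  setUp : PMF (PP × MSK)
  extract : PP → MSK → ID → PMF SK
  reKeyGen : PP → SK → ID → ID → PMF RK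
  enc : PP → ID → M → PMF CT
  reEnc : PP → RK → CT → CT
  dec : PP → SK → CT → Option M

namespace IBuPRE

variable {PP MSK ID SK RK CT M : Type}

/-- Encrypt `m` under `id` and decrypt with a key extracted for `id`. -/
def encDec (S : IBuPRE PP MSK ID SK RK CT M) (id : ID) (m : M) : PMF (Option M) := do
  let keys ← S.setUp
  let sk ← S.extract keys.1 keys.2 id
  let ct ← S.enc keys.1 id m
  return S.dec keys.1 sk ct

/-- Encrypt `m` under `idi`, re-encrypt from `idi` to `idj`, and decrypt with a key extracted
for `idj`. -/
def encReEncDec (S : IBuPRE PP MSK ID SK RK CT M) (idi idj : ID) (m : M) :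
    PMF (Option M) := do
  let keys ← S.setUp
  let ski ← S.extract keys.1 keys.2 idi
  let skj ← S.extract keys.1 keys.2 idj
  let rk ← S.reKeyGen keys.1 ski idi idj
  let ct ← S.enc keys.1 idi m
  return S.dec keys.1 skj (S.reEnc keys.1 rk ct)

end IBuPRE

/-- Single-hop correctness of a scheme (a family indexed by the security parameter): both original
and re-encrypted ciphertexts decrypt to the encrypted message with overwhelming probability,
uniformly in the identities and the message. -/
def SingleHopCorrect {PP MSK ID SK RK CT M : ℕ → Type}
    (S : ∀ n, IBuPRE (PP n) (MSK n) (ID n) (SK n) (RK n) (CT n) (M n)) : Prop :=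
  ∃ ε : ℕ → ℝ, Negligible ε ∧ ∀ n,
    (∀ (id : ID n) (m : M n), 1 - ε n ≤ ((S n).encDec id m (some m)).toReal) ∧
    (∀ (idi idj : ID n) (m : M n), 1 - ε n ≤ ((S n).encReEncDec idi idj m (some m)).toReal)

/-! ### Gadget matrix, binary decomposition and powers of two -/

/-- `k = ⌈log₂ q⌉`. -/
abbrev bitLen (q : ℕ) : ℕ := Nat.clog 2 q

/-- The gadget matrix `G = I_n ⊗ (1, 2, 4, …, 2^(k-1))`, an `n × nk` matrix over `ℤ_q`. -/
def gadget (n q : ℕ) : Matrix (Fin n) (Fin n × Fin (bitLen q)) (ZMod q) :=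
  Matrix.of fun i c => if i = c.1 then 2 ^ (c.2 : ℕ) else 0

/-- `BD(c)`: the `k` bits of each of the coordinates of `c`, taken in `{0, …, q-1}`. -/
def bitDecomp {ι : Type} {q : ℕ} (c : ι → ZMod q) : ι × Fin (bitLen q) → ZMod q :=
  fun p => if (c p.1).val.testBit p.2 then 1 else 0

/-- `P2(x)`: the multiples `x, 2x, …, 2^(k-1) x` modulo `q`. -/
def powersOfTwo {ι : Type} (q : ℕ) (x : ι → ℤ) : ι × Fin (bitLen q) → ZMod q :=
  fun p => 2 ^ (p.2 : ℕ) * (x p.1 : ZMod q)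

/-- Reduction of an integer vector modulo `q`. -/
def vecMod {ι : Type} (q : ℕ) (x : ι → ℤ) : ι → ZMod q := fun i => (x i : ZMod q)

/-- Reduction of an integer matrix modulo `q`. -/
def matMod {ι κ : Type} (q : ℕ) (R : Matrix ι κ ℤ) : Matrix ι κ (ZMod q) :=
  R.map (fun z => (z : ZMod q))

/-- The coset `Λ_u^⊥(A) = {z ∈ ℤ^κ : A z = u mod q}`. -/
def latticeCoset {ι κ : Type} [Fintype κ] {q : ℕ} (A : Matrix ι κ (ZMod q)) (u : ι → ZMod q) :
    Set (κ → ℤ) :=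
  {z | A.mulVec (vecMod q z) = u}

/-- Distance on `ℤ_q`: the absolute value of the representative of `x - y` in `(-q/2, q/2]`. -/
def zmodDist {q : ℕ} (x y : ZMod q) : ℕ := (x - y).valMinAbs.natAbs

/-! ### The adaptively secure scheme -/

namespace Adaptive

/-- Parameters: dimension `n`, modulus `q`, width `mbar` of `Ā`, identity length `l`, Gaussian
parameter `r` of the trapdoors and of the re-encryption keys, Gaussian parameter `s` of the user
keys, LWE error rate `α`. -/
structure Params where
  n : ℕ
  q : ℕ
  [q_ne : NeZero q]
  mbar : ℕ
  l : ℕ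
  r : ℝ
  s : ℝ
  α : ℝ

attribute [instance] Params.q_ne

variable (P : Params)

/-- The `nk` columns of the gadget matrix. -/
abbrev GCol : Type := Fin P.n × Fin (bitLen P.q)

/-- The `m = mbar + nk` columns of `A_id`. -/
abbrev Col : Type := Fin P.mbar ⊕ GCol P

/-- Identities `(b_1, …, b_l) ∈ {-1, 1}^l`. -/
abbrev Ident : Type := Fin P.l → ℤˣ

/-- Public parameters `(Ā, Ā_1, …, Ā_l, u_0, u_1, …, u_l)`. -/
structure PubParams where
  Abar : Matrix (Fin P.n) (Fin P.mbar) (ZMod P.q)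
  A : Fin P.l → Matrix (Fin P.n) (GCol P) (ZMod P.q)
  u0 : Fin P.n → ZMod P.q
  u : Fin P.l → Fin P.n → ZMod P.q

/-- Master secret keys `(R_1, …, R_l)`. -/
abbrev MasterKey : Type := Fin P.l → Matrix (Fin P.mbar) (GCol P) ℤ

/-- User keys `x_id ∈ ℤ^m`. -/
abbrev UserKey : Type := Col P → ℤ

/-- Ciphertexts `(c_1, c_2) ∈ ℤ_q^m × ℤ_q`. -/
abbrev Cipher : Type := (Col P → ZMod P.q) × ZMod P.q

/-- Re-encryption keys: `(mk + 1) × (m + 1)` matrices over `ℤ_q`. -/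
abbrev ReKey : Type :=
  Matrix ((Col P × Fin (bitLen P.q)) ⊕ Unit) (Col P ⊕ Unit) (ZMod P.q)

variable {P}

/-- `A_id = [Ā | ∑ b_j Ā_j + G]`. -/
def identMat (pp : PubParams P) (id : Ident P) : Matrix (Fin P.n) (Col P) (ZMod P.q) :=
  Matrix.fromCols pp.Abar ((∑ j, (id j : ℤ) • pp.A j) + gadget P.n P.q)

/-- `u_id = u_0 + ∑ b_j u_j`. -/
def identVec (pp : PubParams P) (id : Ident P) : Fin P.n → ZMod P.q :=
  pp.u0 + ∑ j, (id j : ℤ) • pp.u j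

variable (P)

/-- The matrices `R_1, …, R_l` are independent with distribution `D_{ℤ, r}^{mbar × nk}`. -/
def sampleMasterKey : PMF (MasterKey P) :=
  (gaussVec (Fin P.l × Fin P.mbar × GCol P) P.r).map
    (fun z j => Matrix.of fun a c => z (j, a, c))

def setUp : PMF (PubParams P × MasterKey P) := do
  let Abar ← PMF.uniformOfFintype (Matrix (Fin P.n) (Fin P.mbar) (ZMod P.q))
  let R ← sampleMasterKey P
  let u0 ← PMF.uniformOfFintype (Fin P.n → ZMod P.q)
  let u ← PMF.uniformOfFintype (Fin P.l → Fin P.n → ZMod P.q)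
  return (⟨Abar, fun j => -(Abar * matMod P.q (R j)), u0, u⟩, R)

/-- The user key has distribution `D_{Λ_{u_id}^⊥(A_id), s}`. -/
def extract (pp : PubParams P) (_msk : MasterKey P) (id : Ident P) : PMF (UserKey P) :=
  discreteGaussian (latticeCoset (identMat pp id) (identVec pp id)) P.s

/-- `b · ⌊q/2⌋` for a bit `b`. -/
def encode (q : ℕ) (b : Bool) : ZMod q := if b then ((q / 2 : ℕ) : ZMod q) else 0

def enc (pp : PubParams P) (id : Ident P) (b : Bool) : PMF (Cipher P) := do
  let t ← PMF.uniformOfFintype (Fin P.n → ZMod P.q)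
  let e ← gaussInt (P.α * P.q)
  let e0 ← gaussVec (Fin P.mbar) (P.α * P.q)
  let e1 ← gaussVec (GCol P)
    (Real.sqrt (((∑ i, (e0 i : ℝ) ^ 2) + P.mbar * (P.α * P.q) ^ 2) * P.r ^ 2))
  return ((identMat pp id).transpose.mulVec t + vecMod P.q (Sum.elim e0 e1),
    dotProduct (identVec pp id) t + (e : ZMod P.q) + encode P.q b)

/-- Compute `b' = c_2 - x_idᵗ c_1`; output `0` if `b'` is closer to `0` than to `⌊q/2⌋`, and `1`
otherwise. -/
def dec (_pp : PubParams P) (x : UserKey P) (ct : Cipher P) : Option Bool :=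
  let b' : ZMod P.q := ct.2 - dotProduct (vecMod P.q x) ct.1
  if zmodDist b' 0 < zmodDist b' ((P.q / 2 : ℕ) : ZMod P.q) then some false else some true

/-- `rk = [ r₁ A_idj , r₁ u_idj + r₂ - P2(x_idi) ; 0 , 1 ]`. -/
def reKeyGen (pp : PubParams P) (x : UserKey P) (_idi idj : Ident P) : PMF (ReKey P) := do
  let r1 ← gaussMat (Col P × Fin (bitLen P.q)) (Fin P.n) P.r
  let r2 ← gaussVec (Col P × Fin (bitLen P.q)) P.r
  return Matrix.fromBlocks
    (matMod P.q r1 * identMat pp idj)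
    (Matrix.replicateCol Unit ((matMod P.q r1).mulVec (identVec pp idj) + vecMod P.q r2
      - powersOfTwo P.q x))
    0 1

/-- `[c̄_1 | c̄_2] = [BD(c_1) | c_2] · rk`. -/
def reEnc (_pp : PubParams P) (rk : ReKey P) (ct : Cipher P) : Cipher P :=
  let v : Col P ⊕ Unit → ZMod P.q :=
    Matrix.vecMul (Sum.elim (bitDecomp ct.1) (fun _ => ct.2)) rk
  (fun c => v (Sum.inl c), v (Sum.inr ()))

/-- The scheme with parameters `P`, for one-bit messages. -/
def scheme : IBuPRE (PubParams P) (MasterKey P) (Ident P) (UserKey P) (ReKey P) (Cipher P) Bool where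
  setUp := setUp P
  extract := extract P
  reKeyGen := reKeyGen P
  enc := enc P
  reEnc := reEnc P
  dec := dec P

/-- The distribution of `(Ā, Ā R)` for uniform `Ā` and `R` from `D_{ℤ, r}^{mbar × nk}`. -/
def trapdoorPair : PMF (Matrix (Fin P.n) (Fin P.mbar) (ZMod P.q) ×
    Matrix (Fin P.n) (GCol P) (ZMod P.q)) := do
  let Abar ← PMF.uniformOfFintype (Matrix (Fin P.n) (Fin P.mbar) (ZMod P.q))
  let R ← gaussMat (Fin P.mbar) (GCol P) P.r
  return (Abar, Abar * matMod P.q R)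

/-- Statistical distance of `(Ā, Ā R)` from uniform. -/
def trapdoorDist : ℝ :=
  statDist (trapdoorPair P) (PMF.uniformOfFintype _)

end Adaptive

end

/-!
# Correctness of the adaptively secure identity-based proxy re-encryption scheme

Write `N = nk`, where `k` is the bit length of `q`. Decrypting a ciphertext of `b` under `id` with a
key `x = (x₀, x₁)` such that `A_id x = u_id` leaves `b ⌊q/2⌋` plus the noise
`e - ⟨x₀, e₀⟩ - ⟨x₁, e₁⟩`, and re-encryption adds `⟨BD(c₁), r₂⟩` to it (`enc_noise_eq`,
`reEnc_noise_eq`). Decryption succeeds as long as the noise stays below about `q / 4`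
(`dec_eq_of_noise`), so everything rests on bounds for Gaussian vectors.

*Norms of user keys.* No lower bound on `s` is assumed, so `s` may lie below the smoothing parameter
of the lattice. The tail bound `exists_gaussNormTail` holds for every `s > 0`: on a coset of a
lattice in `ℤ^m` that contains a vector `z`, a discrete Gaussian has squared norm
`O(‖z‖² + s² m)` except with probability `exp (-m)`. It is a counting argument: in a grid of cubes
of side `s`, the coset points of any cube can be translated close to `z`, so they are not more
numerous, up to a factor `exp (O(m + ‖z‖² / s²))`, than the Gaussian mass of the coset allows.
A short `z` exists with overwhelming probability, because `u_id` is uniform and independent of `Ā`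
while `(Ā, Ā ρ)` is nearly uniform for a column `ρ` of a Gaussian matrix
(`setUp_short_solution_fail_le`). Together, `‖x‖² = O(N² r⁴)`.

*Inner products.* By Poisson summation the one-dimensional Gaussian sum is largest at the unshifted
lattice (`Real.tsum_exp_neg_mul_add_sq_le`), which makes Gaussian vectors subgaussian with the
optimal constant (`gaussVec_inner_tail`): `|⟨x, e⟩| < t ‖x‖ s` up to probability `2 exp (-π t²)`.
As `‖e₀‖² = O(N (αq)²)`, the noise is `O(t αq · N^(3/2) r³) = O(q · t r / √N)`. The choice
`t² = k √n / r` makes `exp (-π t²)` negligible, since `k ≥ log n` and `r = o(√n)`, and still gives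
`t r / √N = √(r / √n) → 0`. The term `⟨BD(c₁), r₂⟩` is at most `O(r N k)` by the Cauchy–Schwarz
inequality, and this is `o(N^(3/2) r)` because `q` is polynomial in `n`.
-/

/-! ### Gaussian sums over integer lattices -/

theorem ENNReal.tsum_pi_prod {ι : Type*} [Fintype ι] {α : Type*} (f : ι → α → ENNReal) :
    ∑' x : ι → α, ∏ i, f i (x i) = ∏ i, ∑' a, f i a := by
  refine Fintype.induction_empty_option
    (P := fun ι _ => ∀ f : ι → α → ENNReal, ∑' x : ι → α, ∏ i, f i (x i) = ∏ i, ∑' a, f i a)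
    ?_ ?_ ?_ ι f
  · intro ι κ _ e ih f
    let _ := Fintype.ofEquiv κ e.symm
    rw [← e.prod_comp, ← (Equiv.arrowCongr e (Equiv.refl α)).tsum_eq]
    convert ih (fun i => f (e i)) using 3 with x
    rw [← e.prod_comp]
    simp
  · intro f
    simp
  · intro ι _ ih f
    rw [← (Equiv.piOptionEquivProd (β := fun _ => α)).symm.tsum_eq, ENNReal.tsum_prod']
    simp [Fintype.prod_option, Equiv.piOptionEquivProd_symm_apply, ENNReal.tsum_mul_left, ih,
      ENNReal.tsum_mul_right]

theorem Real.summable_exp_neg_mul_add_sq {a : ℝ} (ha : 0 < a) (β : ℝ) :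
    Summable fun n : ℤ => Real.exp (-Real.pi / a * ((n : ℝ) + β) ^ 2) := by
  have := (summable_jacobiTheta₂_term_iff ((β / a : ℝ) * Complex.I) ((1 / a : ℝ) * Complex.I)).2
    (by simpa using ha)
  rw [← summable_norm_iff] at this
  refine (this.mul_left (Real.exp (-Real.pi / a * β ^ 2))).congr fun n => ?_
  rw [norm_jacobiTheta₂_term, ← Real.exp_add]
  congr 1
  simp
  field_simp
  ring

/-- Among all real translates of `ℤ` the Gaussian sum is largest for `ℤ` itself: by Poisson
summation, the sum over a translate is a Fourier series with positive coefficients. -/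
theorem Real.tsum_exp_neg_mul_add_sq_le {a : ℝ} (ha : 0 < a) (β : ℝ) :
    ∑' n : ℤ, Real.exp (-Real.pi / a * ((n : ℝ) + β) ^ 2) ≤
      ∑' n : ℤ, Real.exp (-Real.pi / a * (n : ℝ) ^ 2) := by
  have h0 := Real.tsum_exp_neg_mul_int_sq ha
  have h1 := Complex.tsum_exp_neg_quadratic (a := a) (by simpa using ha) (-Complex.I * β)
  have hpow : (a : ℂ) ^ (1 / 2 : ℂ) = ((a ^ (1 / 2 : ℝ) : ℝ) : ℂ) := by
    rw [Complex.ofReal_cpow ha.le]; norm_num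
  have hap : 0 < a ^ (1 / 2 : ℝ) := Real.rpow_pos_of_pos ha _
  have h2 : (∑' n : ℤ, Complex.exp (-Real.pi / a * (n + Complex.I * (-Complex.I * β)) ^ 2))
      = ((∑' n : ℤ, Real.exp (-Real.pi / a * ((n : ℝ) + β) ^ 2) : ℝ) : ℂ) := by
    rw [Complex.ofReal_tsum]
    congr 1 with n
    have : Complex.I * (-Complex.I * β) = β := by
      rw [← mul_assoc, mul_neg, Complex.I_mul_I]; simp
    rw [this]
    push_cast
    rfl
  rw [h2, hpow] at h1
  have h3 : ‖∑' n : ℤ, Complex.exp (-Real.pi * a * n ^ 2 + 2 * Real.pi * (-Complex.I * β) * n)‖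
      ≤ ∑' n : ℤ, Real.exp (-Real.pi * a * (n : ℝ) ^ 2) := by
    have hn : ∀ n : ℤ, ‖Complex.exp (-Real.pi * a * n ^ 2 + 2 * Real.pi * (-Complex.I * β) * n)‖
        = Real.exp (-Real.pi * a * (n : ℝ) ^ 2) := by
      intro n
      rw [Complex.norm_exp]
      congr 1
      have : (-Real.pi * a * n ^ 2 + 2 * Real.pi * (-Complex.I * β) * n : ℂ)
          = ((-Real.pi * a * n ^ 2 : ℝ) : ℂ) + ((-2 * Real.pi * β * n : ℝ) : ℂ) * Complex.I := by
        push_cast; ring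
      rw [this, Complex.add_re, Complex.ofReal_re, Complex.re_ofReal_mul]
      simp
    refine (norm_tsum_le_tsum_norm ?_).trans_eq (tsum_congr hn)
    refine (Real.summable_exp_neg_mul_add_sq (inv_pos.2 ha) 0).congr fun n => ?_
    rw [hn]; congr 1; field_simp; simp
  rw [h1, ← Complex.ofReal_one, ← Complex.ofReal_div, ← Complex.ofReal_mul, Complex.norm_real,
    h0] at h3
  have h4 := (le_abs_self _).trans h3
  exact le_of_mul_le_mul_left h4 (by positivity)

/-- The squared Euclidean norm of an integer vector, as a real number. -/
noncomputable def normSq {ι : Type} [Fintype ι] (x : ι → ℤ) : ℝ := ∑ i, (x i : ℝ) ^ 2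

theorem normSq_nonneg {ι : Type} [Fintype ι] (x : ι → ℤ) : 0 ≤ normSq x :=
  Finset.sum_nonneg fun _ _ => sq_nonneg _

/-- The Gaussian weight `exp (-π ‖x‖² / s²)` without restriction to a set. -/
noncomputable def gaussRho {ι : Type} [Fintype ι] (s : ℝ) (x : ι → ℤ) : ENNReal :=
  ENNReal.ofReal (Real.exp (-Real.pi * normSq x / s ^ 2))

theorem gaussWeight_eq_indicator {ι : Type} [Fintype ι] (Λ : Set (ι → ℤ)) (s : ℝ) :
    gaussWeight Λ s = Λ.indicator (gaussRho s) := rfl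

theorem gaussRho_ne_zero {ι : Type} [Fintype ι] (s : ℝ) (x : ι → ℤ) : gaussRho s x ≠ 0 := by
  simp [gaussRho, Real.exp_pos]

theorem gaussRho_eq_prod {ι : Type} [Fintype ι] (s : ℝ) (x : ι → ℤ) :
    gaussRho s x = ∏ i, ENNReal.ofReal (Real.exp (-Real.pi / s ^ 2 * (x i : ℝ) ^ 2)) := by
  rw [← ENNReal.ofReal_prod_of_nonneg fun _ _ => (Real.exp_pos _).le, ← Real.exp_sum,
    ← Finset.mul_sum, gaussRho, normSq]
  congr 2
  ring

theorem tsum_exp_neg_mul_add_sq_ne_top {a : ℝ} (ha : 0 < a) (β : ℝ) :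
    ∑' n : ℤ, ENNReal.ofReal (Real.exp (-Real.pi / a * ((n : ℝ) + β) ^ 2)) ≠ ⊤ :=
  (Real.summable_exp_neg_mul_add_sq ha β).tsum_ofReal_ne_top

theorem tsum_gaussRho_ne_top {ι : Type} [Fintype ι] {s : ℝ} (hs : 0 < s) :
    ∑' x : ι → ℤ, gaussRho s x ≠ ⊤ := by
  simp_rw [gaussRho_eq_prod]
  rw [ENNReal.tsum_pi_prod (fun (_ : ι) (n : ℤ) =>
    ENNReal.ofReal (Real.exp (-Real.pi / s ^ 2 * (n : ℝ) ^ 2)))]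
  refine ENNReal.prod_ne_top fun i _ => ?_
  simpa using tsum_exp_neg_mul_add_sq_ne_top (pow_pos hs 2) 0

theorem tsum_gaussWeight_ne_top {ι : Type} [Fintype ι] (Λ : Set (ι → ℤ)) {s : ℝ} (hs : 0 < s) :
    ∑' x, gaussWeight Λ s x ≠ ⊤ := by
  refine ne_top_of_le_ne_top (tsum_gaussRho_ne_top hs) (ENNReal.tsum_le_tsum fun x => ?_)
  exact Set.indicator_le_self _ _ _

theorem tsum_gaussWeight_ne_zero {ι : Type} [Fintype ι] {Λ : Set (ι → ℤ)} (hΛ : Λ.Nonempty)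
    (s : ℝ) : ∑' x, gaussWeight Λ s x ≠ 0 := by
  obtain ⟨x, hx⟩ := hΛ
  intro h
  have := ENNReal.tsum_eq_zero.1 h x
  rw [gaussWeight_eq_indicator, Set.indicator_of_mem hx] at this
  exact gaussRho_ne_zero s x this

theorem discreteGaussian_toOuterMeasure_le {ι : Type} [Fintype ι] {Λ : Set (ι → ℤ)}
    (hΛ : Λ.Nonempty) {s : ℝ} (hs : 0 < s) {S : Set (ι → ℤ)} {δ : ENNReal}
    (h : ∑' x, S.indicator (gaussWeight Λ s) x ≤ δ * ∑' x, gaussWeight Λ s x) :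
    (discreteGaussian Λ s).toOuterMeasure S ≤ δ := by
  have h0 := tsum_gaussWeight_ne_zero hΛ s
  have h1 := tsum_gaussWeight_ne_top Λ hs
  rw [discreteGaussian, dif_pos ⟨h0, h1⟩, PMF.toOuterMeasure_apply]
  have : ∀ x, S.indicator (PMF.normalize (gaussWeight Λ s) h0 h1) x
      = S.indicator (gaussWeight Λ s) x * (∑' x, gaussWeight Λ s x)⁻¹ := by
    intro x
    by_cases hx : x ∈ S <;> simp [hx]
  rw [tsum_congr this, ENNReal.tsum_mul_right, ← div_eq_mul_inv]
  exact ENNReal.div_le_of_le_mul h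

theorem discreteGaussian_support_subset {ι : Type} [Fintype ι] {Λ : Set (ι → ℤ)}
    (hΛ : Λ.Nonempty) {s : ℝ} (hs : 0 < s) : (discreteGaussian Λ s).support ⊆ Λ := by
  rw [discreteGaussian, dif_pos ⟨tsum_gaussWeight_ne_zero hΛ s, tsum_gaussWeight_ne_top Λ hs⟩,
    PMF.support_normalize, gaussWeight_eq_indicator]
  exact Set.support_indicator_subset

/-! ### Norm tail bound on lattice cosets -/

/-- The part of a Gaussian sum of width `√2 s` over a coset that lies in one cell of a cubical
grid of side `s`. Translating by a difference of two points of the cell moves the cell near a given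
point `z` of the coset, so the cell contains few points compared with the sum of width `s`. -/
theorem tsum_cell_le {ι : Type} [Fintype ι] {Λ : Set (ι → ℤ)}
    (hΛ : ∀ x ∈ Λ, ∀ y ∈ Λ, ∀ z ∈ Λ, z + (x - y) ∈ Λ) {s : ℝ} (hs : 0 < s) {z : ι → ℤ}
    (hz : z ∈ Λ) (j : ι → ℤ) :
    ∑' x, {x | (fun i => ⌊(x i : ℝ) / s⌋) = j}.indicator (Λ.indicator (gaussRho (√2 * s))) x ≤
      (∏ i, ENNReal.ofReal (Real.exp (Real.pi / 2) *
        Real.exp (-Real.pi / 4 * ((j i : ℝ) + 0) ^ 2))) *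
      (ENNReal.ofReal (Real.exp (2 * Real.pi * Fintype.card ι + 2 * Real.pi * normSq z / s ^ 2)) *
      ∑' x, Λ.indicator (gaussRho s) x) := by
  set Q : Set (ι → ℤ) := {x | (fun i => ⌊(x i : ℝ) / s⌋) = j} with hQ
  by_cases hne : ∃ y ∈ Λ, y ∈ Q
  swap
  · have : ∀ x, Q.indicator (Λ.indicator (gaussRho (√2 * s))) x = 0 := by
      intro x
      by_cases hx : x ∈ Q
      · by_cases hx' : x ∈ Λ
        · exact absurd ⟨x, hx', hx⟩ hne
        · simp [hx']
      · simp [hx]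
    simp [this]
  obtain ⟨y, hyΛ, hyQ⟩ := hne
  have hcell : ∀ x ∈ Q, ∀ i, (j i : ℝ) ≤ x i / s ∧ (x i : ℝ) / s < j i + 1 := by
    intro x hx i
    have : ⌊(x i : ℝ) / s⌋ = j i := congrFun hx i
    rw [Int.floor_eq_iff] at this
    exact this
  rw [← (Equiv.addRight (z - y)).tsum_eq (Λ.indicator (gaussRho s)), ← ENNReal.tsum_mul_left,
    ← ENNReal.tsum_mul_left]
  refine ENNReal.tsum_le_tsum fun x => ?_
  by_cases hxQ : x ∈ Q
  swap
  · simp [hxQ]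
  by_cases hxΛ : x ∈ Λ
  swap
  · rw [Set.indicator_of_mem hxQ, Set.indicator_of_notMem hxΛ]
    exact zero_le
  have hmem : x + (z - y) ∈ Λ := by
    have := hΛ x hxΛ y hyΛ z hz
    rwa [show x + (z - y) = z + (x - y) by abel]
  rw [Set.indicator_of_mem hxQ, Set.indicator_of_mem hxΛ, Equiv.coe_addRight,
    Set.indicator_of_mem hmem]
  -- the wide Gaussian is bounded on the cell by a summable function of the cell index
  have hA : gaussRho (√2 * s) x ≤ ∏ i, ENNReal.ofReal (Real.exp (Real.pi / 2) *
      Real.exp (-Real.pi / 4 * ((j i : ℝ) + 0) ^ 2)) := by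
    rw [gaussRho_eq_prod]
    refine Finset.prod_le_prod' fun i _ => ENNReal.ofReal_le_ofReal ?_
    rw [← Real.exp_add, Real.exp_le_exp]
    obtain ⟨h1, h2⟩ := hcell x hxQ i
    set u : ℝ := x i / s with hu
    have hxu : (x i : ℝ) = u * s := by rw [hu]; field_simp
    have : -Real.pi / (√2 * s) ^ 2 * (x i : ℝ) ^ 2 = -Real.pi * (u ^ 2 / 2) := by
      rw [hxu, mul_pow, Real.sq_sqrt (by norm_num)]; field_simp
    rw [this]
    have hj : ((j i : ℝ) + 0) ^ 2 ≤ 2 * u ^ 2 + 2 := by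
      nlinarith [sq_nonneg (u + (u - j i))]
    nlinarith [Real.pi_pos]
  -- the translate of `x` that moves `y` to `z` has Gaussian weight bounded below
  have hB : 1 ≤ ENNReal.ofReal (Real.exp (2 * Real.pi * Fintype.card ι +
      2 * Real.pi * normSq z / s ^ 2)) * gaussRho s (x + (z - y)) := by
    rw [gaussRho, ← ENNReal.ofReal_mul (Real.exp_pos _).le, ← Real.exp_add,
      ← ENNReal.ofReal_one]
    refine ENNReal.ofReal_le_ofReal (Real.one_le_exp ?_)
    have hn : normSq (x + (z - y)) ≤ 2 * normSq z + 2 * (Fintype.card ι * s ^ 2) := by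
      have : ∀ i ∈ Finset.univ, (((x + (z - y)) i : ℤ) : ℝ) ^ 2 ≤
          2 * (z i : ℝ) ^ 2 + 2 * s ^ 2 := by
        intro i _
        obtain ⟨h1, h2⟩ := hcell x hxQ i
        obtain ⟨h3, h4⟩ := hcell y hyQ i
        rw [le_div_iff₀ hs] at h1 h3
        rw [div_lt_iff₀ hs] at h2 h4
        have h5 : ((x i : ℝ) - y i) ^ 2 ≤ s ^ 2 := sq_le_sq' (by linarith) (by linarith)
        simp only [Pi.add_apply, Pi.sub_apply, Int.cast_add, Int.cast_sub]
        nlinarith [sq_nonneg ((z i : ℝ) - (x i - y i))]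
      refine (Finset.sum_le_sum this).trans_eq ?_
      rw [Finset.sum_add_distrib, ← Finset.mul_sum, normSq]
      simp
      ring
    have : -Real.pi * normSq (x + (z - y)) / s ^ 2 ≥
        -Real.pi * (2 * normSq z + 2 * (Fintype.card ι * s ^ 2)) / s ^ 2 := by
      refine div_le_div_of_nonneg_right ?_ (by positivity)
      nlinarith [Real.pi_pos]
    have h2 : -Real.pi * (2 * normSq z + 2 * (Fintype.card ι * s ^ 2)) / s ^ 2
      = -(2 * Real.pi * Fintype.card ι + 2 * Real.pi * normSq z / s ^ 2) := by
      field_simp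
      ring
    linarith
  calc gaussRho (√2 * s) x ≤ _ := hA
    _ = _ * 1 := (mul_one _).symm
    _ ≤ _ := mul_le_mul_right hB _

/-- Widening a Gaussian by the factor `√2` increases the sum over a coset of a lattice in `ℤ^ι`
at most exponentially in the dimension and in `‖z‖² / s²`, for any vector `z` of the coset. -/
theorem exists_tsum_gaussRho_sqrt_two_le :
    ∃ C : ℝ, 0 < C ∧ ∀ {ι : Type} [Fintype ι] {Λ : Set (ι → ℤ)}
      (_ : ∀ x ∈ Λ, ∀ y ∈ Λ, ∀ z ∈ Λ, z + (x - y) ∈ Λ) {s : ℝ} (_ : 0 < s) {z : ι → ℤ}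
      (_ : z ∈ Λ),
      ∑' x, Λ.indicator (gaussRho (√2 * s)) x ≤
        ENNReal.ofReal (Real.exp (C * Fintype.card ι + 2 * Real.pi * normSq z / s ^ 2)) *
          ∑' x, Λ.indicator (gaussRho s) x := by
  set H : ENNReal := ∑' n : ℤ, ENNReal.ofReal (Real.exp (Real.pi / 2) *
        Real.exp (-Real.pi / 4 * ((n : ℝ) + 0) ^ 2)) with hH
  have hHtop : H ≠ ⊤ :=
    ((Real.summable_exp_neg_mul_add_sq (by norm_num : (0 : ℝ) < 4) 0).mul_left
      (Real.exp (Real.pi / 2))).tsum_ofReal_ne_top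
  have hHle : H ≤ ENNReal.ofReal (Real.exp H.toReal) := by
    rw [← ENNReal.ofReal_toReal hHtop]
    refine ENNReal.ofReal_le_ofReal ?_
    rw [ENNReal.toReal_ofReal ENNReal.toReal_nonneg]
    linarith [Real.add_one_le_exp H.toReal]
  refine ⟨H.toReal + 2 * Real.pi, by positivity, ?_⟩
  intro ι _ Λ hΛ s hs z hz
  classical
  have hsplit : ∑' x, Λ.indicator (gaussRho (√2 * s)) x = ∑' j : ι → ℤ, ∑' x,
      {x : ι → ℤ | (fun i => ⌊(x i : ℝ) / s⌋) = j}.indicator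
        (Λ.indicator (gaussRho (√2 * s))) x := by
    rw [ENNReal.tsum_comm]
    refine tsum_congr fun x => ?_
    rw [tsum_eq_single (fun i => ⌊(x i : ℝ) / s⌋)]
    · simp
    · intro j hj
      simp [hj.symm]
  rw [hsplit]
  refine (ENNReal.tsum_le_tsum fun j => tsum_cell_le hΛ hs hz j).trans ?_
  rw [ENNReal.tsum_mul_right, ENNReal.tsum_pi_prod (fun (_ : ι) (n : ℤ) =>
    ENNReal.ofReal (Real.exp (Real.pi / 2) * Real.exp (-Real.pi / 4 * ((n : ℝ) + 0) ^ 2))),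
    ← hH, Finset.prod_const, Finset.card_univ, ← mul_assoc]
  gcongr
  calc _ ≤ ENNReal.ofReal (Real.exp H.toReal) ^ Fintype.card ι * ENNReal.ofReal
        (Real.exp (2 * Real.pi * Fintype.card ι + 2 * Real.pi * normSq z / s ^ 2)) := by gcongr
    _ = _ := by
      rw [← ENNReal.ofReal_pow (Real.exp_pos _).le, ← ENNReal.ofReal_mul (by positivity),
        ← Real.exp_nat_mul, ← Real.exp_add]
      congr 2
      ring

/-- Tail bound for the norm of a discrete Gaussian vector on a coset of a lattice, for every width
`s > 0`: the norm is at most of the order of `s √M` plus the length of any vector `z` of the coset,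
where `M` is at least the dimension. The constant `C` does not depend on the dimension. -/
def GaussNormTail (C : ℝ) : Prop :=
  ∀ {ι : Type} [Fintype ι] {Λ : Set (ι → ℤ)}
    (_ : ∀ x ∈ Λ, ∀ y ∈ Λ, ∀ z ∈ Λ, z + (x - y) ∈ Λ) {s : ℝ} (_ : 0 < s) {z : ι → ℤ}
    (_ : z ∈ Λ) {M R : ℝ} (_ : Fintype.card ι ≤ M) (_ : 4 * normSq z + C * s ^ 2 * M ≤ R),
    (discreteGaussian Λ s).toOuterMeasure {x | R ≤ normSq x} ≤ ENNReal.ofReal (Real.exp (-M))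

theorem exists_gaussNormTail : ∃ C : ℝ, 0 < C ∧ GaussNormTail C := by
  obtain ⟨C, hC, h⟩ := exists_tsum_gaussRho_sqrt_two_le
  refine ⟨C + 1, by positivity, ?_⟩
  intro ι _ Λ hΛ s hs z hz M R hM hR
  refine discreteGaussian_toOuterMeasure_le ⟨z, hz⟩ hs ?_
  rw [gaussWeight_eq_indicator]
  -- at distance `√R` from the origin the Gaussian is far below the one that is wider by `√2`
  have h1 : ∀ x, {x | R ≤ normSq x}.indicator (Λ.indicator (gaussRho s)) x ≤
      ENNReal.ofReal (Real.exp (-Real.pi * R / (2 * s ^ 2))) *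
        Λ.indicator (gaussRho (√2 * s)) x := by
    intro x
    by_cases hx : R ≤ normSq x
    swap
    · rw [Set.indicator_of_notMem (by simpa using hx)]; exact zero_le
    by_cases hxΛ : x ∈ Λ
    swap
    · simp [hxΛ]
    rw [Set.indicator_of_mem (show x ∈ {x | R ≤ normSq x} from hx), Set.indicator_of_mem hxΛ,
      Set.indicator_of_mem hxΛ, gaussRho, gaussRho, ← ENNReal.ofReal_mul (Real.exp_pos _).le,
      ← Real.exp_add]
    refine ENNReal.ofReal_le_ofReal (Real.exp_le_exp.2 ?_)
    rw [mul_pow, Real.sq_sqrt (by norm_num), ← add_div, div_le_div_iff₀ (by positivity)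
      (by positivity)]
    have : 0 < s ^ 2 * Real.pi := by positivity
    nlinarith
  refine (ENNReal.tsum_le_tsum h1).trans ?_
  rw [ENNReal.tsum_mul_left]
  refine (mul_le_mul_right (h hΛ hs hz) _).trans ?_
  rw [← mul_assoc, ← ENNReal.ofReal_mul (Real.exp_pos _).le, ← Real.exp_add]
  gcongr
  have hM0 : 0 ≤ M := le_trans (by positivity) hM
  have e1 : Real.pi * R / (2 * s ^ 2) ≥
      Real.pi * (4 * normSq z + (C + 1) * s ^ 2 * M) / (2 * s ^ 2) := by gcongr
  have e2 : Real.pi * (4 * normSq z + (C + 1) * s ^ 2 * M) / (2 * s ^ 2)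
      = 2 * Real.pi * normSq z / s ^ 2 + Real.pi / 2 * ((C + 1) * M) := by
    field_simp
    ring
  have e3 : (C + 1) * M ≤ Real.pi / 2 * ((C + 1) * M) :=
    le_mul_of_one_le_left (by positivity) (by linarith [Real.pi_gt_three])
  have e4 : C * (Fintype.card ι : ℝ) ≤ C * M := by gcongr
  have e5 : -Real.pi * R / (2 * s ^ 2) = -(Real.pi * R / (2 * s ^ 2)) := by ring
  rw [e5]
  linarith

theorem GaussNormTail.gaussVec {C : ℝ} (hC : GaussNormTail C) {ι : Type} [Fintype ι] {s : ℝ}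
    (hs : 0 < s) {M : ℝ} (hM : Fintype.card ι ≤ M) :
    (gaussVec ι s).toOuterMeasure {x | C * s ^ 2 * M ≤ normSq x} ≤
      ENNReal.ofReal (Real.exp (-M)) :=
  hC (fun _ _ _ _ _ _ => Set.mem_univ _) hs (Set.mem_univ (0 : ι → ℤ)) hM (by simp [normSq])

/-! ### Inner products with Gaussian vectors -/

/-- The discrete Gaussian on `ℤ^ι` is subgaussian. In the degenerate case `s = 0` it is the point
mass at `0`, and the bound holds trivially. -/
theorem gaussVec_inner_tail {ι : Type} [Fintype ι] {s : ℝ} (hs : 0 ≤ s) (x : ι → ℤ) {B t : ℝ}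
    (hB : 0 < B) (ht : 0 < t) (hxB : normSq x * s ^ 2 ≤ B ^ 2) :
    (gaussVec ι s).toOuterMeasure {e | t * B ≤ ∑ i, (x i : ℝ) * e i} ≤
      ENNReal.ofReal (Real.exp (-Real.pi * t ^ 2)) := by
  rcases hs.eq_or_lt with rfl | hs
  · refine le_of_eq_of_le ?_ zero_le
    rw [PMF.toOuterMeasure_apply_eq_zero_iff, Set.disjoint_left]
    intro e he
    rw [Set.mem_ofPred_eq, not_le]
    have he0 : ∑ i, (x i : ℝ) * e i = 0 := by
      rcases isEmpty_or_nonempty ι with hι | hι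
      · simp
      · have htop : ∑' y : ι → ℤ, gaussWeight Set.univ 0 y = ⊤ := by
          simp only [gaussWeight_eq_indicator, Set.indicator_univ, gaussRho]
          simp
        rw [gaussVec, discreteGaussian, dif_neg (by simp [htop]), PMF.mem_support_pure_iff] at he
        simp [he]
    rw [he0]
    positivity
  refine discreteGaussian_toOuterMeasure_le Set.univ_nonempty hs ?_
  rw [gaussWeight_eq_indicator, Set.indicator_univ]
  -- the exponential Markov inequality, with the exponent that is optimal for `‖x‖ s = B`
  set c : ℝ := t * s ^ 2 / B with hc
  have h1 : ∀ e, {e : ι → ℤ | t * B ≤ ∑ i, (x i : ℝ) * e i}.indicator (gaussRho s) e ≤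
      ENNReal.ofReal (Real.exp (-Real.pi * t ^ 2)) *
        ∏ i, ENNReal.ofReal (Real.exp (-Real.pi / s ^ 2 * ((e i : ℝ) + -(c * x i)) ^ 2)) := by
    intro e
    by_cases he : t * B ≤ ∑ i, (x i : ℝ) * e i
    swap
    · rw [Set.indicator_of_notMem (by simpa using he)]; exact zero_le
    have hmem : e ∈ {e : ι → ℤ | t * B ≤ ∑ i, (x i : ℝ) * e i} := he
    rw [Set.indicator_of_mem hmem, gaussRho,
      ← ENNReal.ofReal_prod_of_nonneg fun _ _ => (Real.exp_pos _).le, ← Real.exp_sum,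
      ← ENNReal.ofReal_mul (Real.exp_pos _).le, ← Real.exp_add]
    refine ENNReal.ofReal_le_ofReal (Real.exp_le_exp.2 ?_)
    have e1 : ∑ i, -Real.pi / s ^ 2 * ((e i : ℝ) + -(c * x i)) ^ 2 =
        -Real.pi / s ^ 2 * (normSq e - 2 * c * ∑ i, (x i : ℝ) * e i + c ^ 2 * normSq x) := by
      simp only [normSq, Finset.mul_sum, ← Finset.sum_sub_distrib, ← Finset.sum_add_distrib]
      refine Finset.sum_congr rfl fun i _ => ?_
      ring
    have e2 : c ^ 2 * normSq x ≤ t ^ 2 * s ^ 2 := by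
      rw [hc, div_pow, div_mul_eq_mul_div, div_le_iff₀ (by positivity)]
      calc (t * s ^ 2) ^ 2 * normSq x = t ^ 2 * s ^ 2 * (normSq x * s ^ 2) := by ring
        _ ≤ t ^ 2 * s ^ 2 * B ^ 2 := by gcongr
    have e3 : t ^ 2 * s ^ 2 ≤ c * ∑ i, (x i : ℝ) * e i := by
      calc t ^ 2 * s ^ 2 = c * (t * B) := by rw [hc]; field_simp
        _ ≤ _ := by gcongr
    have e4 : ∀ y : ℝ, -Real.pi * t ^ 2 + -Real.pi / s ^ 2 * y =
        -Real.pi * (t ^ 2 * s ^ 2 + y) / s ^ 2 := by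
      intro y
      field_simp
      ring
    rw [e1, e4]
    refine div_le_div_of_nonneg_right ?_ (by positivity)
    nlinarith [Real.pi_pos]
  refine (ENNReal.tsum_le_tsum h1).trans ?_
  rw [ENNReal.tsum_mul_left, ENNReal.tsum_pi_prod (fun (i : ι) (n : ℤ) =>
    ENNReal.ofReal (Real.exp (-Real.pi / s ^ 2 * ((n : ℝ) + -(c * x i)) ^ 2)))]
  simp_rw [gaussRho_eq_prod]
  rw [ENNReal.tsum_pi_prod (fun (_ : ι) (n : ℤ) =>
    ENNReal.ofReal (Real.exp (-Real.pi / s ^ 2 * (n : ℝ) ^ 2)))]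
  refine mul_le_mul_right (Finset.prod_le_prod' fun i _ => ?_) _
  have hs2 : 0 < s ^ 2 := by positivity
  rw [← ENNReal.ofReal_tsum_of_nonneg (fun _ => (Real.exp_pos _).le)
      (Real.summable_exp_neg_mul_add_sq hs2 _),
    ← ENNReal.ofReal_tsum_of_nonneg (fun _ => (Real.exp_pos _).le)
      (by simpa using Real.summable_exp_neg_mul_add_sq hs2 0)]
  exact ENNReal.ofReal_le_ofReal (Real.tsum_exp_neg_mul_add_sq_le hs2 _)

theorem normSq_neg {ι : Type} [Fintype ι] (x : ι → ℤ) : normSq (-x) = normSq x := by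
  simp [normSq]

theorem gaussVec_abs_inner_tail {ι : Type} [Fintype ι] {s : ℝ} (hs : 0 ≤ s) (x : ι → ℤ) {B t : ℝ}
    (hB : 0 < B) (ht : 0 < t) (hxB : normSq x * s ^ 2 ≤ B ^ 2) :
    (gaussVec ι s).toOuterMeasure {e | t * B ≤ |((∑ i, x i * e i : ℤ) : ℝ)|} ≤
      2 * ENNReal.ofReal (Real.exp (-Real.pi * t ^ 2)) := by
  have hsub : {e : ι → ℤ | t * B ≤ |((∑ i, x i * e i : ℤ) : ℝ)|} ⊆
      {e | t * B ≤ ∑ i, (x i : ℝ) * e i} ∪ {e | t * B ≤ ∑ i, ((-x) i : ℝ) * e i} := by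
    intro e he
    rw [Set.mem_ofPred_eq, le_abs] at he
    simpa using he
  refine (MeasureTheory.measure_mono hsub).trans ((MeasureTheory.measure_union_le _ _).trans ?_)
  rw [two_mul]
  gcongr
  · exact gaussVec_inner_tail hs x hB ht hxB
  · have := gaussVec_inner_tail hs (-x) hB ht (by rwa [normSq_neg])
    simpa using this

theorem gaussInt_abs_tail {s : ℝ} (hs : 0 < s) {t : ℝ} (ht : 0 < t) :
    (gaussInt s).toOuterMeasure {e | t * s ≤ |(e : ℝ)|} ≤
      2 * ENNReal.ofReal (Real.exp (-Real.pi * t ^ 2)) := by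
  rw [gaussInt, PMF.toOuterMeasure_map_apply]
  have := gaussVec_abs_inner_tail (ι := Unit) hs.le (fun _ => 1) hs ht (by simp [normSq])
  simpa [gaussVec] using this

theorem gaussMat_col_normSq_tail {ι κ : Type} [Fintype ι] [Fintype κ] {r t : ℝ} (hr : 0 < r)
    (ht : 0 < t) (c : κ) :
    (gaussMat ι κ r).toOuterMeasure {R | Fintype.card ι * (t * r) ^ 2 < normSq fun i => R i c} ≤
      Fintype.card ι * (2 * ENNReal.ofReal (Real.exp (-Real.pi * t ^ 2))) := by
  classical
  rw [gaussMat, PMF.toOuterMeasure_map_apply]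
  have hsub : (fun z : ι × κ → ℤ => Matrix.of fun i j => z (i, j)) ⁻¹'
      {R | Fintype.card ι * (t * r) ^ 2 < normSq fun i => R i c} ⊆
      ⋃ i, {e | t * r ≤ |((∑ j, (Pi.single (i, c) 1 : ι × κ → ℤ) j * e j : ℤ) : ℝ)|} := by
    intro z hz
    by_contra hcon
    simp only [Set.mem_iUnion, Set.mem_ofPred_eq, not_exists, not_le, Pi.single_apply, ite_mul,
      one_mul, zero_mul, Finset.sum_ite_eq', Finset.mem_univ, if_true] at hcon
    change _ < normSq fun i => z (i, c) at hz
    refine absurd hz (not_lt.2 ?_)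
    calc normSq (fun i => z (i, c)) ≤ ∑ _i : ι, (t * r) ^ 2 :=
          Finset.sum_le_sum fun i _ => by
            rw [← sq_abs]; exact pow_le_pow_left₀ (abs_nonneg _) (hcon i).le 2
      _ = _ := by simp
  refine (MeasureTheory.measure_mono hsub).trans
    ((MeasureTheory.measure_iUnion_fintype_le _ _).trans ?_)
  refine (Finset.sum_le_sum fun i _ => gaussVec_abs_inner_tail hr.le (Pi.single (i, c) 1)
    hr ht (le_of_eq ?_)).trans_eq (by simp)
  rw [normSq, Finset.sum_eq_single (i, c)] <;> simp +contextual

/-! ### Probabilities of events under `PMF` -/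

/-- The union bound for a sequential experiment: outside an event `B` of the first stage, the
second stage fails with small probability. -/
theorem PMF.toOuterMeasure_bind_le {α β : Type*} (p : PMF α) (f : α → PMF β) {S : Set β}
    (B : Set α) {δ₁ δ₂ : ENNReal} (h₁ : p.toOuterMeasure B ≤ δ₁)
    (h₂ : ∀ a ∈ p.support, a ∉ B → (f a).toOuterMeasure S ≤ δ₂) :
    (p.bind f).toOuterMeasure S ≤ δ₁ + δ₂ := by
  rw [PMF.toOuterMeasure_bind_apply]
  have : ∀ a, p a * (f a).toOuterMeasure S ≤ B.indicator p a + p a * δ₂ := by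
    intro a
    by_cases ha : a ∈ p.support
    swap
    · simp [(p.apply_eq_zero_iff a).2 ha]
    by_cases haB : a ∈ B
    · rw [Set.indicator_of_mem haB]
      refine le_add_right (mul_le_of_le_one_right' ?_)
      rw [PMF.toOuterMeasure_apply, ← (f a).tsum_coe]
      exact ENNReal.tsum_le_tsum fun x => Set.indicator_le_self _ _ _
    · exact le_add_left (mul_le_mul_right (h₂ a ha haB) _)
  refine (ENNReal.tsum_le_tsum this).trans ?_
  rw [ENNReal.tsum_add, ENNReal.tsum_mul_right, PMF.tsum_coe, one_mul,
    ← PMF.toOuterMeasure_apply]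
  gcongr

theorem PMF.toOuterMeasure_bind_le_of_support {α β : Type*} (p : PMF α) (f : α → PMF β) {S : Set β}
    {δ : ENNReal} (h : ∀ a ∈ p.support, (f a).toOuterMeasure S ≤ δ) :
    (p.bind f).toOuterMeasure S ≤ δ := by
  simpa using PMF.toOuterMeasure_bind_le p f ∅ (δ₁ := 0) (by simp) fun a ha _ => h a ha

theorem PMF.toOuterMeasure_pure_le_zero {α : Type*} {a : α} {S : Set α} (h : a ∉ S) :
    (PMF.pure a).toOuterMeasure S ≤ 0 := by
  classical
  rw [PMF.toOuterMeasure_pure_apply, if_neg h]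

theorem PMF.one_sub_le_toReal_of_compl_le {α : Type*} (p : PMF α) (a : α) {δ : ℝ} (hδ : 0 ≤ δ)
    (h : p.toOuterMeasure {a}ᶜ ≤ ENNReal.ofReal δ) : 1 - δ ≤ (p a).toReal := by
  have h1 : (1 : ENNReal) ≤ p a + ENNReal.ofReal δ := by
    calc (1 : ENNReal) = ∑' x, p x := p.tsum_coe.symm
      _ = ∑' x, (({a} : Set α).indicator p x + ({a}ᶜ : Set α).indicator p x) := by
          refine tsum_congr fun x => ?_
          rw [← Pi.add_apply, Set.indicator_self_add_compl]
      _ = p a + p.toOuterMeasure {a}ᶜ := by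
          rw [ENNReal.tsum_add, ← PMF.toOuterMeasure_apply, ← PMF.toOuterMeasure_apply,
            PMF.toOuterMeasure_apply_singleton]
      _ ≤ _ := by gcongr
  have h2 := ENNReal.toReal_mono (by simp [p.apply_ne_top]) h1
  rw [ENNReal.toReal_add (p.apply_ne_top _) ENNReal.ofReal_ne_top, ENNReal.toReal_ofReal hδ,
    ENNReal.toReal_one] at h2
  linarith

theorem PMF.toOuterMeasure_le_add_statDist {Ω : Type} [Fintype Ω] (P Q : PMF Ω) (S : Set Ω) :
    Q.toOuterMeasure S ≤ P.toOuterMeasure S + ENNReal.ofReal (2 * statDist P Q) := by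
  classical
  have hpt : ∀ w, S.indicator Q w ≤ S.indicator P w +
      ENNReal.ofReal |(P w).toReal - (Q w).toReal| := by
    intro w
    by_cases hw : w ∈ S
    swap
    · simp [hw]
    rw [Set.indicator_of_mem hw, Set.indicator_of_mem hw,
      ← ENNReal.ofReal_toReal (P.apply_ne_top w), ← ENNReal.ofReal_toReal (Q.apply_ne_top w), ← ENNReal.ofReal_add (by simp) (by simp)]
    refine ENNReal.ofReal_le_ofReal ?_
    simp only [ENNReal.toReal_ofReal ENNReal.toReal_nonneg]
    linarith [neg_abs_le ((P w).toReal - (Q w).toReal)]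
  rw [PMF.toOuterMeasure_apply_fintype, PMF.toOuterMeasure_apply_fintype, statDist, tsum_fintype,
    one_div, mul_inv_cancel_left₀ (by norm_num), ENNReal.ofReal_sum_of_nonneg (by simp),
    ← Finset.sum_add_distrib]
  exact Finset.sum_le_sum fun w _ => hpt w

theorem statDist_nonneg {Ω : Type} (P Q : PMF Ω) : 0 ≤ statDist P Q :=
  mul_nonneg (by norm_num) (tsum_nonneg fun _ => abs_nonneg _)

/-! ### Uniform distributions on finite groups -/

theorem PMF.map_uniformOfFintype_addMonoidHom {G H : Type*} [AddGroup G] [AddGroup H] [Fintype G]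
    [Fintype H] (f : G →+ H) (hf : Function.Surjective f) :
    (PMF.uniformOfFintype G).map f = PMF.uniformOfFintype H := by
  classical
  -- the image distribution is invariant under translations
  have hconst : ∀ h, (PMF.uniformOfFintype G).map f h = (PMF.uniformOfFintype G).map f 0 := by
    intro h
    obtain ⟨g, rfl⟩ := hf h
    rw [PMF.map_apply, PMF.map_apply, ← (Equiv.addLeft g).tsum_eq]
    refine tsum_congr fun x => ?_
    simp [eq_comm]
  have hsum := ((PMF.uniformOfFintype G).map f).tsum_coe
  rw [tsum_congr hconst, tsum_fintype, Finset.sum_const, Finset.card_univ, nsmul_eq_mul] at hsum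
  ext h
  rw [hconst h, PMF.uniformOfFintype_apply]
  exact ENNReal.eq_inv_of_mul_eq_one_left (by rwa [mul_comm])

theorem PMF.bind_uniformOfFintype_pair (α β : Type*) [Fintype α] [Fintype β] [Nonempty α]
    [Nonempty β] :
    ((PMF.uniformOfFintype α).bind fun a => (PMF.uniformOfFintype β).bind fun b => PMF.pure (a, b))
      = PMF.uniformOfFintype (α × β) := by
  classical
  ext ⟨a, b⟩
  simp only [PMF.bind_apply, PMF.uniformOfFintype_apply, PMF.pure_apply, tsum_fintype]
  rw [Finset.sum_eq_single a, Finset.sum_eq_single b]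
  · rw [if_pos rfl, mul_one, Fintype.card_prod, Nat.cast_mul,
      ENNReal.mul_inv (by simp) (by simp)]
  · intro b' _ hb
    simp [hb.symm]
  · simp
  · intro a' _ ha
    simp [ha.symm]
  · simp

/-! ### Short vectors in the cosets of a random identity -/

namespace Adaptive

variable {P : Params}

theorem map_setUp_identVec (id : Ident P) :
    (setUp P).map (fun k => (k.1.Abar, identVec k.1 id)) =
      PMF.uniformOfFintype (Matrix (Fin P.n) (Fin P.mbar) (ZMod P.q) × (Fin P.n → ZMod P.q)) := by
  let V := Fin P.n → ZMod P.q
  let f : V × (Fin P.l → V) →+ V :=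
    { toFun := fun p => p.1 + ∑ j, (id j : ℤ) • p.2 j
      map_zero' := by simp
      map_add' := by
        intro a b
        simp only [Prod.fst_add, Prod.snd_add, Pi.add_apply, smul_add, Finset.sum_add_distrib]
        abel }
  have hf : Function.Surjective f := fun v => ⟨(v, 0), by simp [f]⟩
  have hu : ∀ A : Matrix (Fin P.n) (Fin P.mbar) (ZMod P.q),
      ((PMF.uniformOfFintype V).bind fun u0 => (PMF.uniformOfFintype (Fin P.l → V)).bind fun u =>
        PMF.pure (A, u0 + ∑ j, (id j : ℤ) • u j)) =
      (PMF.uniformOfFintype V).bind fun v => PMF.pure (A, v) := by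
    intro A
    conv_rhs => rw [show PMF.uniformOfFintype V =
      (PMF.uniformOfFintype (V × (Fin P.l → V))).map f from
      (PMF.map_uniformOfFintype_addMonoidHom f hf).symm, PMF.bind_map,
      ← PMF.bind_uniformOfFintype_pair, PMF.bind_bind]
    simp only [PMF.bind_bind, PMF.pure_bind]
    rfl
  rw [← PMF.bind_uniformOfFintype_pair]
  change PMF.map _ (PMF.bind _ fun A => PMF.bind _ fun R => PMF.bind _ fun u0 => PMF.bind _ fun u =>
    PMF.pure _) = _
  simp only [PMF.map_bind, PMF.pure_map, PMF.bind_const, identVec]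
  exact congrArg _ (funext hu)

/-- With high probability `Ā z = u_id` has a short solution `z`: the pair `(Ā, u_id)` is uniform,
hence statistically close to `(Ā, Ā ρ)` for a column `ρ` of a Gaussian matrix, and `z = ρ` is a
short solution of `Ā z = Ā ρ`. -/
theorem setUp_short_solution_fail_le (id : Ident P) (hr : 0 < P.r) (c : GCol P) {t : ℝ}
    (ht : 0 < t) :
    (setUp P).toOuterMeasure {k | ¬ ∃ z : Fin P.mbar → ℤ, normSq z ≤ P.mbar * (t * P.r) ^ 2 ∧
        k.1.Abar.mulVec (vecMod P.q z) = identVec k.1 id} ≤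
      P.mbar * (2 * ENNReal.ofReal (Real.exp (-Real.pi * t ^ 2))) +
        ENNReal.ofReal (2 * trapdoorDist P) := by
  let T : Set (Matrix (Fin P.n) (Fin P.mbar) (ZMod P.q) × (Fin P.n → ZMod P.q)) :=
    {w | ¬ ∃ z : Fin P.mbar → ℤ, normSq z ≤ P.mbar * (t * P.r) ^ 2 ∧
        w.1.mulVec (vecMod P.q z) = w.2}
  let f : Matrix (Fin P.n) (Fin P.mbar) (ZMod P.q) × Matrix (Fin P.n) (GCol P) (ZMod P.q) →+
      Matrix (Fin P.n) (Fin P.mbar) (ZMod P.q) × (Fin P.n → ZMod P.q) :=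
    { toFun := fun w => (w.1, fun i => w.2 i c)
      map_zero' := rfl
      map_add' := fun _ _ => rfl }
  have hf : Function.Surjective f := fun w => ⟨(w.1, Matrix.of fun i _ => w.2 i), rfl⟩
  have h1 : (setUp P).toOuterMeasure {k | ¬ ∃ z : Fin P.mbar → ℤ,
      normSq z ≤ P.mbar * (t * P.r) ^ 2 ∧ k.1.Abar.mulVec (vecMod P.q z) = identVec k.1 id} =
      (PMF.uniformOfFintype _).toOuterMeasure (f ⁻¹' T) := by
    rw [← PMF.toOuterMeasure_map_apply, PMF.map_uniformOfFintype_addMonoidHom f hf,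
      ← map_setUp_identVec id, PMF.toOuterMeasure_map_apply]
    rfl
  rw [h1]
  refine (PMF.toOuterMeasure_le_add_statDist (trapdoorPair P) _ _).trans ?_
  refine add_le_add_left ?_ _
  refine PMF.toOuterMeasure_bind_le_of_support _ _ fun A _ => ?_
  have h2 := gaussMat_col_normSq_tail (ι := Fin P.mbar) (κ := GCol P) hr ht c
  rw [Fintype.card_fin] at h2
  refine (PMF.toOuterMeasure_bind_le _ _ _ h2 (δ₂ := 0) fun R _ hR => ?_).trans_eq (add_zero _)
  refine PMF.toOuterMeasure_pure_le_zero (not_not.2 ?_)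
  refine ⟨fun i => R i c, not_lt.1 hR, ?_⟩
  rfl

end Adaptive

/-! ### Bits, distances modulo `q`, and decryption -/

theorem Nat.sum_testBit_mul_two_pow (k a : ℕ) (ha : a < 2 ^ k) :
    ∑ j : Fin k, (if a.testBit j then 1 else 0) * 2 ^ (j : ℕ) = a := by
  induction k generalizing a with
  | zero => simp at ha; simp [ha]
  | succ k ih =>
    rw [Fin.sum_univ_succ]
    have h := ih (a / 2) (by rw [Nat.div_lt_iff_lt_mul two_pos, ← pow_succ]; exact ha)
    have h2 : ∑ j : Fin k, (if a.testBit (j.succ : Fin (k + 1)) then 1 else 0) *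
        2 ^ ((j.succ : Fin (k + 1)) : ℕ) = 2 * (a / 2) := by
      conv_rhs => rw [← h]
      rw [Finset.mul_sum]
      refine Finset.sum_congr rfl fun j _ => ?_
      rw [Fin.val_succ, Nat.testBit_succ, pow_succ]
      ring
    rw [h2]
    rcases Nat.mod_two_eq_zero_or_one a with h0 | h0 <;> simp [Nat.testBit_zero, h0] <;> omega

theorem bitDecomp_dotProduct_powersOfTwo {ι : Type} [Fintype ι] {q : ℕ} [NeZero q]
    (c : ι → ZMod q) (x : ι → ℤ) :
    dotProduct (bitDecomp c) (powersOfTwo q x) = dotProduct (vecMod q x) c := by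
  simp only [dotProduct, Fintype.sum_prod_type]
  refine Finset.sum_congr rfl fun i _ => ?_
  have h := Nat.sum_testBit_mul_two_pow (bitLen q) (c i).val
    ((ZMod.val_lt _).trans_le (Nat.le_pow_clog one_lt_two q))
  have h2 := congrArg (Nat.cast : ℕ → ZMod q) h
  rw [ZMod.natCast_zmod_val] at h2
  conv_rhs => rw [← h2]
  rw [Nat.cast_sum, Finset.mul_sum]
  refine Finset.sum_congr rfl fun j _ => ?_
  simp only [bitDecomp, powersOfTwo, vecMod]
  split_ifs <;> simp [mul_comm]

theorem ZMod.natAbs_valMinAbs_intCast {q : ℕ} [NeZero q] {a : ℤ} (ha : 2 * a.natAbs < q) :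
    (a : ZMod q).valMinAbs.natAbs = a.natAbs := by
  rw [(ZMod.valMinAbs_spec (a : ZMod q) a).2 ⟨rfl, by constructor <;> omega⟩]

namespace Adaptive

variable {P : Params}

theorem dec_eq_of_noise {pp : PubParams P} {x : UserKey P} {ct : Cipher P} {b : Bool} {ν : ℤ}
    (hν : 4 * ν.natAbs + 2 ≤ P.q)
    (h : ct.2 - dotProduct (vecMod P.q x) ct.1 = (ν : ZMod P.q) + encode P.q b) :
    dec P pp x ct = some b := by
  have hd : (ν : ZMod P.q).valMinAbs.natAbs = ν.natAbs :=
    ZMod.natAbs_valMinAbs_intCast (by omega)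
  have hq : ((P.q / 2 : ℕ) : ZMod P.q).valMinAbs.natAbs = P.q / 2 := by
    rw [ZMod.valMinAbs_natCast_of_le_half le_rfl, Int.natAbs_natCast]
  simp only [dec, h, zmodDist, sub_zero, encode]
  generalize ((P.q / 2 : ℕ) : ZMod P.q) = w at hq ⊢
  -- `w = ⌊q/2⌋` is far from `0`, so a point near one of them is far from the other
  cases b
  · simp only [Bool.false_eq_true, if_false, add_zero, hd]
    have h1 := ZMod.natAbs_valMinAbs_add_le ((ν : ZMod P.q)) (-((ν : ZMod P.q) - w))
    rw [show (ν : ZMod P.q) + -((ν : ZMod P.q) - w) = w by ring,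
      hq] at h1
    have h2 := Int.natAbs_add_le (ν : ZMod P.q).valMinAbs
      (-((ν : ZMod P.q) - w)).valMinAbs
    rw [ZMod.natAbs_valMinAbs_neg, hd] at h2
    rw [if_pos (by omega)]
  · simp only [if_true, add_sub_cancel_right, hd]
    have h1 := ZMod.natAbs_valMinAbs_add_le ((ν : ZMod P.q) + w) (-(ν : ZMod P.q))
    rw [show (ν : ZMod P.q) + w + -(ν : ZMod P.q) = w by ring,
      hq] at h1
    have h2 := Int.natAbs_add_le ((ν : ZMod P.q) + w).valMinAbs
      (-(ν : ZMod P.q)).valMinAbs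
    rw [ZMod.natAbs_valMinAbs_neg, hd] at h2
    rw [if_neg (by omega)]

/-! ### User keys -/

theorem latticeCoset_affine {ι κ : Type} [Fintype κ] {q : ℕ} (A : Matrix ι κ (ZMod q))
    (u : ι → ZMod q) : ∀ x ∈ latticeCoset A u, ∀ y ∈ latticeCoset A u, ∀ z ∈ latticeCoset A u,
      z + (x - y) ∈ latticeCoset A u := by
  intro x hx y hy z hz
  have hv : vecMod q (z + (x - y)) = vecMod q z + (vecMod q x - vecMod q y) := by
    ext i; simp [vecMod]
  simp only [latticeCoset, Set.mem_ofPred_eq] at *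
  rw [hv, Matrix.mulVec_add, Matrix.mulVec_sub, hx, hy, hz, sub_self, add_zero]

theorem sumElim_zero_mem_latticeCoset {pp : PubParams P} {id : Ident P} {z : Fin P.mbar → ℤ}
    (hz : pp.Abar.mulVec (vecMod P.q z) = identVec pp id) :
    Sum.elim z 0 ∈ latticeCoset (identMat pp id) (identVec pp id) := by
  have hv : vecMod P.q (Sum.elim z 0 : Col P → ℤ) = Sum.elim (vecMod P.q z) 0 := by
    ext i; cases i <;> simp [vecMod]
  simp only [latticeCoset, Set.mem_ofPred_eq]
  rw [hv, identMat, Matrix.fromCols_mulVec]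
  simpa using hz

theorem normSq_sumElim {ι κ : Type} [Fintype ι] [Fintype κ] (x : ι → ℤ) (y : κ → ℤ) :
    normSq (Sum.elim x y) = normSq x + normSq y := by
  simp [normSq]

theorem extract_normSq_tail {C : ℝ} (hC : GaussNormTail C) (hs : 0 < P.s) {pp : PubParams P}
    {msk : MasterKey P} {id : Ident P} {z : Fin P.mbar → ℤ}
    (hz : pp.Abar.mulVec (vecMod P.q z) = identVec pp id) {M X : ℝ}
    (hM : Fintype.card (Col P) ≤ M) (hX : 4 * normSq z + C * P.s ^ 2 * M ≤ X) :
    (extract P pp msk id).toOuterMeasure {x | X ≤ normSq x} ≤ ENNReal.ofReal (Real.exp (-M)) :=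
  hC (latticeCoset_affine _ _) hs (sumElim_zero_mem_latticeCoset hz) hM
    (by rw [normSq_sumElim]; simpa [normSq] using hX)

/-! ### The noise of a ciphertext -/

theorem enc_noise_eq {pp : PubParams P} {id : Ident P} {x : UserKey P}
    (hx : x ∈ latticeCoset (identMat pp id) (identVec pp id)) (t : Fin P.n → ZMod P.q) (e : ℤ)
    (w : Col P → ℤ) (v : ZMod P.q) :
    dotProduct (identVec pp id) t + (e : ZMod P.q) + v -
        dotProduct (vecMod P.q x) ((identMat pp id).transpose.mulVec t + vecMod P.q w) =
      ((e - ∑ i, x i * w i : ℤ) : ZMod P.q) + v := by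
  have hx' : (identMat pp id).mulVec (vecMod P.q x) = identVec pp id := hx
  rw [dotProduct_add, Matrix.mulVec_transpose, dotProduct_comm (vecMod P.q x) (Matrix.vecMul _ _),
    ← Matrix.dotProduct_mulVec, hx', dotProduct_comm t]
  have : dotProduct (vecMod P.q x) (vecMod P.q w) = ((∑ i, x i * w i : ℤ) : ZMod P.q) := by
    simp [dotProduct, vecMod]
  rw [this]
  push_cast
  ring

/-- The vector `BD(c)` as an integer vector. -/
def intBits {ι : Type} {q : ℕ} (c : ι → ZMod q) : ι × Fin (bitLen q) → ℤ :=
  fun p => if (c p.1).val.testBit p.2 then 1 else 0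

/-- Re-encryption from `xi` to `xj` adds the inner product of the bits of the ciphertext with `r₂`
to the noise; the part with `r₁` cancels against the key `xj`. -/
theorem reEnc_noise_eq {pp : PubParams P} {idj : Ident P} {xj : UserKey P}
    (hxj : xj ∈ latticeCoset (identMat pp idj) (identVec pp idj)) (xi : UserKey P)
    (r1 : Matrix (Col P × Fin (bitLen P.q)) (Fin P.n) ℤ) (r2 : Col P × Fin (bitLen P.q) → ℤ)
    (ct : Cipher P) :
    let rk : ReKey P := Matrix.fromBlocks (matMod P.q r1 * identMat pp idj)
      (Matrix.replicateCol Unit ((matMod P.q r1).mulVec (identVec pp idj) + vecMod P.q r2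
        - powersOfTwo P.q xi)) 0 1
    (reEnc P pp rk ct).2 - dotProduct (vecMod P.q xj) (reEnc P pp rk ct).1 =
      ((∑ p, intBits ct.1 p * r2 p : ℤ) : ZMod P.q) +
        (ct.2 - dotProduct (vecMod P.q xi) ct.1) := by
  intro rk
  have hxj' : (identMat pp idj).mulVec (vecMod P.q xj) = identVec pp idj := hxj
  have h1 : (reEnc P pp rk ct).1 =
      Matrix.vecMul (bitDecomp ct.1) (matMod P.q r1 * identMat pp idj) := by
    ext i
    simp [reEnc, rk, Matrix.vecMul_fromBlocks]
  have h2 : (reEnc P pp rk ct).2 = dotProduct (bitDecomp ct.1)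
      ((matMod P.q r1).mulVec (identVec pp idj) + vecMod P.q r2 - powersOfTwo P.q xi) + ct.2 := by
    simp [reEnc, rk, Matrix.vecMul, Matrix.replicateCol, dotProduct]
  have h3 : dotProduct (vecMod P.q xj) (reEnc P pp rk ct).1 =
      dotProduct (bitDecomp ct.1) ((matMod P.q r1).mulVec (identVec pp idj)) := by
    rw [h1, dotProduct_comm, ← Matrix.dotProduct_mulVec, ← Matrix.mulVec_mulVec, hxj']
  have h4 : dotProduct (bitDecomp ct.1) (vecMod P.q r2) =
      ((∑ p, intBits ct.1 p * r2 p : ℤ) : ZMod P.q) := by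
    simp [dotProduct, bitDecomp, intBits, vecMod]
  rw [h3, h2, dotProduct_sub, dotProduct_add, h4, bitDecomp_dotProduct_powersOfTwo]
  ring

end Adaptive

/-! ### Failure probability for fixed parameters -/

namespace Adaptive

variable {P : Params}

/-- The ciphertexts that the key `x` does not decrypt to `b` with a noise of size at most `T`. -/
def badCipher (x : UserKey P) (b : Bool) (T : ℝ) : Set (Cipher P) :=
  {ct | ¬ ∃ ν : ℤ, |(ν : ℝ)| ≤ T ∧
    ct.2 - dotProduct (vecMod P.q x) ct.1 = (ν : ZMod P.q) + encode P.q b}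

theorem enc_badCipher_le {C : ℝ} (hC0 : 0 < C) (hC : GaussNormTail C) (hr : 0 < P.r)
    (hα : 0 < P.α) {pp : PubParams P} {id : Ident P} {x : UserKey P} (b : Bool)
    (hx : x ∈ latticeCoset (identMat pp id) (identVec pp id)) {X M t T : ℝ} (hX : normSq x ≤ X)
    (hX0 : 0 < X) (hM : P.mbar ≤ M) (hM0 : 0 < M) (ht : 0 < t)
    (hT : t * (P.α * P.q) * (1 + √X + √X * √((C + 1) * M) * P.r) ≤ T) :
    (enc P pp id b).toOuterMeasure (badCipher x b T) ≤
      ENNReal.ofReal (Real.exp (-M)) + 6 * ENNReal.ofReal (Real.exp (-Real.pi * t ^ 2)) := by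
  set σ : ℝ := P.α * P.q with hσ
  have hσ0 : 0 < σ := mul_pos hα (Nat.cast_pos.2 (NeZero.pos _))
  set p : ENNReal := ENNReal.ofReal (Real.exp (-Real.pi * t ^ 2))
  have hsplit : normSq x = normSq (fun i => x (Sum.inl i)) + normSq (fun i => x (Sum.inr i)) := by
    simp [normSq]
  have hx0 : normSq (fun i => x (Sum.inl i)) ≤ X := by
    linarith [normSq_nonneg fun i => x (Sum.inr i)]
  have hx1 : normSq (fun i => x (Sum.inr i)) ≤ X := by
    linarith [normSq_nonneg fun i => x (Sum.inl i)]
  have hfinal : ENNReal.ofReal (Real.exp (-M)) + 6 * p =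
      2 * p + ((ENNReal.ofReal (Real.exp (-M)) + 2 * p) + (2 * p + 0)) := by ring
  -- the failure events of `e`, `e₀` and `e₁`, in the order of sampling
  rw [hfinal]
  refine PMF.toOuterMeasure_bind_le_of_support _ _ fun v _ => ?_
  refine PMF.toOuterMeasure_bind_le _ _ _ (gaussInt_abs_tail hσ0 ht) fun e _ he => ?_
  have htail0 : (gaussVec (Fin P.mbar) σ).toOuterMeasure ({y | C * σ ^ 2 * M ≤ normSq y} ∪
      {y | t * (√X * σ) ≤ |((∑ i, x (Sum.inl i) * y i : ℤ) : ℝ)|}) ≤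
      ENNReal.ofReal (Real.exp (-M)) + 2 * p := by
    refine (MeasureTheory.measure_union_le _ _).trans (add_le_add ?_ ?_)
    · exact hC.gaussVec hσ0 (by simpa using hM)
    · refine gaussVec_abs_inner_tail hσ0.le (fun i => x (Sum.inl i)) (by positivity) ht ?_
      have hsq : (√X * σ) ^ 2 = X * σ ^ 2 := by rw [mul_pow, Real.sq_sqrt hX0.le]
      rw [hsq]
      exact mul_le_mul_of_nonneg_right hx0 (sq_nonneg σ)
  refine PMF.toOuterMeasure_bind_le _ _ _ htail0 fun e0 _ he0 => ?_
  rw [Set.mem_union, not_or, Set.mem_ofPred_eq, Set.mem_ofPred_eq, not_le, not_le] at he0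
  obtain ⟨he0n, he0x⟩ := he0
  set s' : ℝ := √(((∑ i, (e0 i : ℝ) ^ 2) + P.mbar * σ ^ 2) * P.r ^ 2) with hs'
  have hs'le : s' ^ 2 ≤ (C + 1) * M * (σ * P.r) ^ 2 := by
    rw [hs', Real.sq_sqrt (by positivity)]
    have h1 : ∑ i, (e0 i : ℝ) ^ 2 ≤ C * σ ^ 2 * M := he0n.le
    have h2 : P.mbar * σ ^ 2 ≤ M * σ ^ 2 := by gcongr
    calc _ ≤ (C * σ ^ 2 * M + M * σ ^ 2) * P.r ^ 2 := by gcongr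
      _ = _ := by ring
  have htail1 : (gaussVec (GCol P) s').toOuterMeasure
      {y | t * (√X * √((C + 1) * M) * (σ * P.r)) ≤ |((∑ i, x (Sum.inr i) * y i : ℤ) : ℝ)|} ≤
      2 * p := by
    refine gaussVec_abs_inner_tail (Real.sqrt_nonneg _) (fun i => x (Sum.inr i)) (by positivity)
      ht ?_
    have hsq : (√X * √((C + 1) * M) * (σ * P.r)) ^ 2 = X * ((C + 1) * M * (σ * P.r) ^ 2) := by
      rw [mul_pow, mul_pow, Real.sq_sqrt hX0.le, Real.sq_sqrt (by positivity), mul_assoc]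
    rw [hsq]
    exact mul_le_mul hx1 hs'le (sq_nonneg _) hX0.le
  refine PMF.toOuterMeasure_bind_le _ _ _ htail1 fun e1 _ he1 => ?_
  rw [Set.mem_ofPred_eq, not_le] at he he1
  refine PMF.toOuterMeasure_pure_le_zero ?_
  intro hmem
  refine hmem ⟨e - ∑ i, x i * (Sum.elim e0 e1 : Col P → ℤ) i, ?_,
    enc_noise_eq hx v e (Sum.elim e0 e1) _⟩
  rw [Fintype.sum_sum_type]
  simp only [Sum.elim_inl, Sum.elim_inr]
  push_cast at he0x he1 ⊢
  refine le_trans ?_ hT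
  have h1 := abs_sub (e : ℝ) ((∑ i, (x (Sum.inl i) : ℝ) * e0 i) + ∑ i, (x (Sum.inr i) : ℝ) * e1 i)
  have h2 := abs_add_le (∑ i, (x (Sum.inl i) : ℝ) * e0 i) (∑ i, (x (Sum.inr i) : ℝ) * e1 i)
  calc _ ≤ t * σ + (t * (√X * σ) + t * (√X * √((C + 1) * M) * (σ * P.r))) := by linarith
    _ = _ := by ring

theorem abs_sum_intBits_mul_le {ι : Type} [Fintype ι] {q : ℕ} (c : ι → ZMod q)
    (y : ι × Fin (bitLen q) → ℤ) {Y : ℝ} (hY : normSq y ≤ Y) :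
    |((∑ p, intBits c p * y p : ℤ) : ℝ)| ≤ √((Fintype.card ι * bitLen q : ℕ) * Y) := by
  refine Real.abs_le_sqrt ?_
  push_cast
  refine (Finset.sum_mul_sq_le_sq_mul_sq _ _ _).trans ?_
  refine mul_le_mul ?_ hY (normSq_nonneg y) (by positivity)
  refine (Finset.sum_le_sum (g := fun _ => (1 : ℝ)) fun p _ => ?_).trans_eq ?_
  · unfold intBits
    split_ifs <;> simp
  · simp

theorem dec_eq_of_notMem_badCipher {pp : PubParams P} {x : UserKey P} {b : Bool} {T : ℝ}
    {ct : Cipher P} (hT : 4 * T + 2 ≤ P.q) (h : ct ∉ badCipher x b T) :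
    dec P pp x ct = some b := by
  obtain ⟨ν, hν, h⟩ := not_not.1 h
  refine dec_eq_of_noise ?_ h
  have : ((4 * ν.natAbs + 2 : ℕ) : ℝ) ≤ P.q := by
    push_cast
    rw [Nat.cast_natAbs, Int.cast_abs]
    linarith
  exact_mod_cast this

/-- The quantities that bound the failure probability for one value of the security parameter:
`M` bounds the dimensions, `t` and `τ` are the deviations allowed in Gaussian inner products and in
the entries of the trapdoor, `X` bounds the squared norm of user keys, and `T`, `T'` bound the noise
of a ciphertext and the noise added by re-encryption. -/
structure NoiseBounds (P : Params) (C M t τ X T T' : ℝ) : Prop where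
  r_pos : 0 < P.r
  s_pos : 0 < P.s
  α_pos : 0 < P.α
  t_pos : 0 < t
  τ_pos : 0 < τ
  X_pos : 0 < X
  n_pos : 0 < P.n
  bitLen_pos : 0 < bitLen P.q
  card_le : Fintype.card (Col P) ≤ M
  key_le : 4 * (P.mbar * (τ * P.r) ^ 2) + C * P.s ^ 2 * M ≤ X
  noise_le : t * (P.α * P.q) * (1 + √X + √X * √((C + 1) * M) * P.r) ≤ T
  reEnc_le : √C * P.r * (M * bitLen P.q) ≤ T'
  q_ge : 4 * (T' + T) + 2 ≤ P.q

namespace NoiseBounds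

variable {C M t τ X T T' : ℝ}

theorem mbar_le (h : NoiseBounds P C M t τ X T T') : P.mbar ≤ M := by
  refine le_trans ?_ h.card_le
  rw [Nat.cast_le, Fintype.card_sum, Fintype.card_fin]
  exact Nat.le_add_right _ _

theorem M_pos (h : NoiseBounds P C M t τ X T T') : 0 < M := by
  refine lt_of_lt_of_le ?_ h.card_le
  have : 0 < P.n * bitLen P.q := Nat.mul_pos h.n_pos h.bitLen_pos
  rw [Nat.cast_pos]
  simp only [Fintype.card_sum, Fintype.card_prod, Fintype.card_fin]
  omega

theorem T'_nonneg (h : NoiseBounds P C M t τ X T T') : 0 ≤ T' := by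
  have h1 := h.r_pos
  have h2 := h.M_pos
  exact le_trans (by positivity) h.reEnc_le

/-- A bound for the probability that the coset of a given identity has no short vector. -/
noncomputable def keyFail (P : Params) (τ : ℝ) : ENNReal :=
  P.mbar * (2 * ENNReal.ofReal (Real.exp (-Real.pi * τ ^ 2))) + ENNReal.ofReal (2 * trapdoorDist P)

theorem setUp_fail_le (h : NoiseBounds P C M t τ X T T') (id : Ident P) :
    (setUp P).toOuterMeasure {k | ¬ ∃ z : Fin P.mbar → ℤ, normSq z ≤ P.mbar * (τ * P.r) ^ 2 ∧
      k.1.Abar.mulVec (vecMod P.q z) = identVec k.1 id} ≤ keyFail P τ :=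
  setUp_short_solution_fail_le id h.r_pos (⟨0, h.n_pos⟩, ⟨0, h.bitLen_pos⟩) h.τ_pos

theorem encDec_fail_le (hC0 : 0 < C) (hC : GaussNormTail C) (h : NoiseBounds P C M t τ X T T')
    (id : Ident P) (b : Bool) :
    ((scheme P).encDec id b).toOuterMeasure {some b}ᶜ ≤
      keyFail P τ + (ENNReal.ofReal (Real.exp (-M)) +
        (ENNReal.ofReal (Real.exp (-M)) + 6 * ENNReal.ofReal (Real.exp (-Real.pi * t ^ 2)))) := by
  refine PMF.toOuterMeasure_bind_le _ _ _ (h.setUp_fail_le id) fun k _ hk => ?_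
  obtain ⟨z, hz, hzu⟩ := not_not.1 hk
  refine PMF.toOuterMeasure_bind_le _ _ _ (extract_normSq_tail hC h.s_pos (msk := k.2) hzu
    h.card_le (X := X) (by linarith [h.key_le])) fun x hx hxX => ?_
  have hxc := discreteGaussian_support_subset ⟨_, sumElim_zero_mem_latticeCoset hzu⟩ h.s_pos hx
  refine (PMF.toOuterMeasure_bind_le _ _ _ (enc_badCipher_le hC0 hC h.r_pos h.α_pos b hxc
    (not_le.1 hxX).le h.X_pos h.mbar_le h.M_pos h.t_pos h.noise_le) (δ₂ := 0)
      fun ct _ hct => ?_).trans_eq (add_zero _)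
  refine PMF.toOuterMeasure_pure_le_zero ?_
  exact not_not.2 (dec_eq_of_notMem_badCipher (pp := k.1) (by linarith [h.q_ge, h.T'_nonneg]) hct)

theorem encReEncDec_fail_le (hC0 : 0 < C) (hC : GaussNormTail C)
    (h : NoiseBounds P C M t τ X T T') (idi idj : Ident P) (b : Bool) :
    ((scheme P).encReEncDec idi idj b).toOuterMeasure {some b}ᶜ ≤
      (keyFail P τ + keyFail P τ) + (ENNReal.ofReal (Real.exp (-M)) +
        (ENNReal.ofReal (Real.exp (-(M * bitLen P.q))) + (ENNReal.ofReal (Real.exp (-M)) +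
          6 * ENNReal.ofReal (Real.exp (-Real.pi * t ^ 2))))) := by
  refine PMF.toOuterMeasure_bind_le _ _ _ ((MeasureTheory.measure_union_le _ _).trans
    (add_le_add (h.setUp_fail_le idi) (h.setUp_fail_le idj))) fun k _ hk => ?_
  rw [Set.mem_union, not_or] at hk
  obtain ⟨z, hz, hzu⟩ := not_not.1 hk.1
  obtain ⟨z', -, hzu'⟩ := not_not.1 hk.2
  refine PMF.toOuterMeasure_bind_le _ _ _ (extract_normSq_tail hC h.s_pos (msk := k.2) hzu
    h.card_le (X := X) (by linarith [h.key_le])) fun xi hxi hxX => ?_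
  have hxc := discreteGaussian_support_subset ⟨_, sumElim_zero_mem_latticeCoset hzu⟩ h.s_pos hxi
  refine PMF.toOuterMeasure_bind_le_of_support _ _ fun xj hxj => ?_
  have hxjc := discreteGaussian_support_subset ⟨_, sumElim_zero_mem_latticeCoset hzu'⟩ h.s_pos hxj
  -- unless `r₂` is long, re-encryption adds a small noise to every ciphertext
  have hrk : ((scheme P).reKeyGen k.1 xi idi idj).toOuterMeasure {rk | ¬ ∀ ct, ∃ μ : ℤ,
      |(μ : ℝ)| ≤ T' ∧ (reEnc P k.1 rk ct).2 - dotProduct (vecMod P.q xj) (reEnc P k.1 rk ct).1 =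
        (μ : ZMod P.q) + (ct.2 - dotProduct (vecMod P.q xi) ct.1)} ≤
      ENNReal.ofReal (Real.exp (-(M * bitLen P.q))) := by
    refine PMF.toOuterMeasure_bind_le_of_support _ _ fun r1 _ => ?_
    have hcard : (Fintype.card (Col P × Fin (bitLen P.q)) : ℝ) ≤ M * bitLen P.q := by
      rw [Fintype.card_prod, Fintype.card_fin, Nat.cast_mul]
      have := h.card_le
      gcongr
    refine (PMF.toOuterMeasure_bind_le _ _ _ (hC.gaussVec h.r_pos hcard) (δ₂ := 0)
      fun r2 _ hr2 => ?_).trans_eq (add_zero _)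
    refine PMF.toOuterMeasure_pure_le_zero ?_
    refine not_not.2 fun ct => ⟨_, ?_, reEnc_noise_eq hxjc xi r1 r2 ct⟩
    refine (abs_sum_intBits_mul_le ct.1 r2 (not_le.1 hr2).le).trans (le_trans ?_ h.reEnc_le)
    have hr := h.r_pos
    have hM := h.M_pos
    refine Real.sqrt_le_iff.2 ⟨by positivity, ?_⟩
    rw [mul_pow, mul_pow, Real.sq_sqrt hC0.le]
    have hc : ((Fintype.card (Col P) * bitLen P.q : ℕ) : ℝ) ≤ M * bitLen P.q := by
      rw [Nat.cast_mul]
      have := h.card_le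
      gcongr
    calc _ ≤ (M * bitLen P.q) * (C * P.r ^ 2 * (M * bitLen P.q)) := by gcongr
      _ = _ := by ring
  refine PMF.toOuterMeasure_bind_le _ _ _ hrk fun rk _ hrk' => ?_
  refine (PMF.toOuterMeasure_bind_le _ _ _ (enc_badCipher_le hC0 hC h.r_pos h.α_pos b hxc
    (not_le.1 hxX).le h.X_pos h.mbar_le h.M_pos h.t_pos h.noise_le) (δ₂ := 0)
      fun ct _ hct => ?_).trans_eq (add_zero _)
  refine PMF.toOuterMeasure_pure_le_zero ?_
  refine not_not.2 (dec_eq_of_notMem_badCipher (pp := k.1) h.q_ge ?_)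
  obtain ⟨μ, hμ, hμe⟩ := not_not.1 hrk' ct
  obtain ⟨ν, hν, hνe⟩ := not_not.1 hct
  refine not_not.2 ⟨μ + ν, ?_, ?_⟩
  · push_cast
    exact (abs_add_le _ _).trans (add_le_add hμ hν)
  · refine hμe.trans ?_
    rw [hνe]
    push_cast
    ring

/-- Both kinds of failure have probability at most this real number. -/
theorem correct (hC0 : 0 < C) (hC : GaussNormTail C) (h : NoiseBounds P C M t τ X T T')
    {δ : ℝ} (hδ : 4 * (P.mbar * Real.exp (-Real.pi * τ ^ 2)) + 4 * trapdoorDist P +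
      3 * Real.exp (-M) + 6 * Real.exp (-Real.pi * t ^ 2) ≤ δ) :
    (∀ (id : Ident P) (b : Bool), 1 - δ ≤ ((scheme P).encDec id b (some b)).toReal) ∧
    (∀ (idi idj : Ident P) (b : Bool),
      1 - δ ≤ ((scheme P).encReEncDec idi idj b (some b)).toReal) := by
  have hd : 0 ≤ trapdoorDist P := statDist_nonneg _ _
  have hδ0 : 0 ≤ δ := le_trans (by positivity) hδ
  have hk : keyFail P τ = ENNReal.ofReal
      (P.mbar * (2 * Real.exp (-Real.pi * τ ^ 2)) + 2 * trapdoorDist P) := by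
    rw [ENNReal.ofReal_add (by positivity) (by positivity), ENNReal.ofReal_mul (by positivity),
      ENNReal.ofReal_mul (by positivity), ENNReal.ofReal_natCast, keyFail, ENNReal.ofReal_ofNat]
  have h6 : 6 * ENNReal.ofReal (Real.exp (-Real.pi * t ^ 2)) =
      ENNReal.ofReal (6 * Real.exp (-Real.pi * t ^ 2)) := by
    rw [ENNReal.ofReal_mul (by positivity), ENNReal.ofReal_ofNat]
  have hMk : Real.exp (-(M * bitLen P.q)) ≤ Real.exp (-M) := by
    rw [Real.exp_le_exp, neg_le_neg_iff]
    have : (1 : ℝ) ≤ bitLen P.q := by exact_mod_cast h.bitLen_pos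
    exact le_mul_of_one_le_right h.M_pos.le this
  have e1 := Real.exp_pos (-M)
  have e2 : 0 ≤ P.mbar * Real.exp (-Real.pi * τ ^ 2) := by positivity
  refine ⟨fun id b => ?_, fun idi idj b => ?_⟩
  · refine PMF.one_sub_le_toReal_of_compl_le _ _ hδ0 ((h.encDec_fail_le hC0 hC id b).trans ?_)
    rw [hk, h6, ← ENNReal.ofReal_add (by positivity) (by positivity),
      ← ENNReal.ofReal_add (by positivity) (by positivity),
      ← ENNReal.ofReal_add (by positivity) (by positivity)]
    exact ENNReal.ofReal_le_ofReal (by linarith)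
  · refine PMF.one_sub_le_toReal_of_compl_le _ _ hδ0
      ((h.encReEncDec_fail_le hC0 hC idi idj b).trans ?_)
    rw [hk, h6, ← ENNReal.ofReal_add (by positivity) (by positivity),
      ← ENNReal.ofReal_add (by positivity) (by positivity),
      ← ENNReal.ofReal_add (by positivity) (by positivity),
      ← ENNReal.ofReal_add (by positivity) (by positivity),
      ← ENNReal.ofReal_add (by positivity) (by positivity)]
    exact ENNReal.ofReal_le_ofReal (by linarith)

end NoiseBounds

end Adaptive

/-! ### Asymptotics of the parameters -/

theorem Real.rpow_three_halves {x : ℝ} (hx : 0 ≤ x) : x ^ (3 / 2 : ℝ) = √x ^ 3 := by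
  rw [Real.sqrt_eq_rpow, ← Real.rpow_natCast, ← Real.rpow_mul hx]
  norm_num

namespace Adaptive

/-- Here `C` is the constant of the norm tail bound, `c₁, …, c₄` are the constants hidden in the
asymptotic hypotheses, and `η`, `η'` are bounds for the small ratios `r / √n` and `√(k / n)` that
leave room for the noise. The entries of a trapdoor column are allowed the large deviation `√N`,
which makes a union bound over them harmless: the resulting `‖z‖² = O(N² r²)` is still below the
order `N² r⁴` of the bound for `s² M`. -/
theorem noiseBounds_of_le {P : Params} {C c₁ c₂ c₃ c₄ η η' N : ℝ} (hC : 0 < C) (hc₁ : 0 < c₁)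
    (hη : 0 < η) (hη' : 0 < η')
    (hn : 0 < P.n) (hk : 0 < bitLen P.q) (hN : N = (P.n * bitLen P.q : ℕ)) (hr : 1 ≤ P.r)
    (hs : 0 < P.s) (hα : 0 < P.α) (hq : 8 ≤ P.q)
    (h₁ : P.mbar ≤ c₁ * N) (h₂ : P.s ≤ c₂ * (√N * P.r ^ 2)) (h₃ : N ^ 2 * P.r ^ 2 * P.α ≤ c₃)
    (h₄ : √N ^ 3 * P.r ≤ c₄ * P.q) (hrη : P.r ≤ η * √P.n) (hkη : bitLen P.q ≤ η' ^ 2 * P.n)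
    (hηs : 16 * (c₃ * (1 + √(4 * c₁ + C * c₂ ^ 2 * (c₁ + 1) + 1) +
      √(4 * c₁ + C * c₂ ^ 2 * (c₁ + 1) + 1) * √((C + 1) * (c₁ + 1))) * √η) ≤ 1)
    (hηs' : 16 * (√C * (c₁ + 1) * η' * c₄) ≤ 1) :
    ∃ T T', NoiseBounds P C ((c₁ + 1) * N) √(bitLen P.q * √P.n / P.r) √N
      ((4 * c₁ + C * c₂ ^ 2 * (c₁ + 1) + 1) * N ^ 2 * P.r ^ 4) T T' := by
  set K : ℝ := 4 * c₁ + C * c₂ ^ 2 * (c₁ + 1) + 1 with hK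
  have hK0 : 0 < K := by positivity
  have hr0 : 0 < P.r := by linarith
  have hnR : (1 : ℝ) ≤ P.n := by exact_mod_cast hn
  have hkR : (1 : ℝ) ≤ bitLen P.q := by exact_mod_cast hk
  have hqR : (8 : ℝ) ≤ P.q := by exact_mod_cast hq
  have hN' : N = P.n * bitLen P.q := by rw [hN]; push_cast; rfl
  have hN1 : 1 ≤ N := by rw [hN']; nlinarith
  set w : ℝ := √N with hw
  have hw1 : 1 ≤ w := Real.one_le_sqrt.2 hN1
  have hwN : w ^ 2 = N := Real.sq_sqrt (by linarith)
  set t : ℝ := √(bitLen P.q * √P.n / P.r) with ht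
  have ht2 : t ^ 2 = bitLen P.q * √P.n / P.r := Real.sq_sqrt (by positivity)
  have htr : t * P.r ≤ √η * w := by
    refine abs_le_of_sq_le_sq' ?_ (by positivity) |>.2
    rw [mul_pow, mul_pow, ht2, Real.sq_sqrt hη.le, hwN, hN']
    have h5 : √(P.n : ℝ) ^ 2 = P.n := Real.sq_sqrt (by positivity)
    calc bitLen P.q * √P.n / P.r * P.r ^ 2 = bitLen P.q * √P.n * P.r := by field_simp
      _ ≤ bitLen P.q * √P.n * (η * √P.n) := by gcongr
      _ = η * (√(P.n : ℝ) ^ 2 * bitLen P.q) := by ring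
      _ = _ := by rw [h5]
  have hsqX : √(K * N ^ 2 * P.r ^ 4) = √K * (w ^ 2 * P.r ^ 2) := by
    rw [show K * N ^ 2 * P.r ^ 4 = K * (N * P.r ^ 2) ^ 2 by ring, Real.sqrt_mul hK0.le,
      Real.sqrt_sq (by positivity), hwN]
  have hsqM : √((C + 1) * ((c₁ + 1) * N)) = √((C + 1) * (c₁ + 1)) * w := by
    rw [← mul_assoc, Real.sqrt_mul (by positivity)]
  have hT : t * (P.α * P.q) * (1 + √(K * N ^ 2 * P.r ^ 4) +
      √(K * N ^ 2 * P.r ^ 4) * √((C + 1) * ((c₁ + 1) * N)) * P.r) ≤ P.q / 16 := by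
    rw [hsqX, hsqM]
    set D := √K
    set E := √((C + 1) * (c₁ + 1))
    have hD : 0 ≤ D := Real.sqrt_nonneg _
    have hE : 0 ≤ E := Real.sqrt_nonneg _
    have hw2 : w ^ 2 ≤ w ^ 3 := pow_le_pow_right₀ hw1 (by norm_num)
    have hr2 : P.r ^ 2 ≤ P.r ^ 3 := pow_le_pow_right₀ hr (by norm_num)
    have h1 : 1 + D * (w ^ 2 * P.r ^ 2) + D * (w ^ 2 * P.r ^ 2) * (E * w) * P.r ≤
        (1 + D + D * E) * (w ^ 3 * P.r ^ 3) := by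
      have e1 : 1 ≤ w ^ 3 * P.r ^ 3 := one_le_mul_of_one_le_of_one_le (one_le_pow₀ hw1)
        (one_le_pow₀ hr)
      have e2 : D * (w ^ 2 * P.r ^ 2) ≤ D * (w ^ 3 * P.r ^ 3) := by gcongr
      linarith
    have h3 : w ^ 4 * P.r ^ 2 * P.α ≤ c₃ := by
      rw [show w ^ 4 = N ^ 2 by rw [← hwN]; ring]; exact h₃
    refine le_of_mul_le_mul_right ?_ (show 0 < w * P.r by positivity)
    calc t * (P.α * P.q) * (1 + D * (w ^ 2 * P.r ^ 2) + D * (w ^ 2 * P.r ^ 2) * (E * w) * P.r) *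
          (w * P.r)
        ≤ t * (P.α * P.q) * ((1 + D + D * E) * (w ^ 3 * P.r ^ 3)) * (w * P.r) := by gcongr
      _ = (t * P.r) * (w ^ 4 * P.r ^ 2 * P.α) * (1 + D + D * E) * P.q * P.r := by ring
      _ ≤ (√η * w) * c₃ * (1 + D + D * E) * P.q * P.r := by gcongr
      _ = (c₃ * (1 + D + D * E) * √η) * (P.q * (w * P.r)) := by ring
      _ ≤ (1 / 16) * (P.q * (w * P.r)) := by gcongr; linarith
      _ = _ := by ring
  have hT' : √C * P.r * ((c₁ + 1) * N * bitLen P.q) ≤ P.q / 16 := by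
    have hkw : (bitLen P.q : ℝ) ≤ η' * w := by
      refine abs_le_of_sq_le_sq' ?_ (by positivity) |>.2
      rw [mul_pow, hwN, hN']
      nlinarith
    calc √C * P.r * ((c₁ + 1) * N * bitLen P.q) ≤ √C * P.r * ((c₁ + 1) * N * (η' * w)) := by
          gcongr
      _ = √C * (c₁ + 1) * η' * (w ^ 3 * P.r) := by rw [← hwN]; ring
      _ ≤ √C * (c₁ + 1) * η' * (c₄ * P.q) := by gcongr
      _ = (√C * (c₁ + 1) * η' * c₄) * P.q := by ring
      _ ≤ (1 / 16) * P.q := by gcongr; linarith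
      _ = _ := by ring
  refine ⟨P.q / 16, P.q / 16, ⟨hr0, hs, hα, Real.sqrt_pos.2 (by positivity), by positivity,
    by positivity, hn, hk, ?_, ?_, hT, hT', by linarith⟩⟩
  · simp only [Fintype.card_sum, Fintype.card_prod, Fintype.card_fin]
    rw [Nat.cast_add, ← hN]
    linarith
  · have hs2 : P.s ^ 2 ≤ c₂ ^ 2 * (N * P.r ^ 4) := by
      calc P.s ^ 2 ≤ (c₂ * (w * P.r ^ 2)) ^ 2 := pow_le_pow_left₀ hs.le h₂ 2
        _ = _ := by rw [← hwN]; ring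
    have hr4 : P.r ^ 2 ≤ P.r ^ 4 := pow_le_pow_right₀ hr (by norm_num)
    calc 4 * (P.mbar * (w * P.r) ^ 2) + C * P.s ^ 2 * ((c₁ + 1) * N)
        = 4 * (P.mbar * (N * P.r ^ 2)) + C * P.s ^ 2 * ((c₁ + 1) * N) := by rw [mul_pow, hwN]
      _ ≤ 4 * (c₁ * N * (N * P.r ^ 4)) + C * (c₂ ^ 2 * (N * P.r ^ 4)) * ((c₁ + 1) * N) := by gcongr
      _ = (K - 1) * N ^ 2 * P.r ^ 4 := by rw [hK]; ring
      _ ≤ K * N ^ 2 * P.r ^ 4 := by gcongr; linarith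

end Adaptive

theorem negligible_exp_neg {G f : ℕ → ℝ} (hf : Tendsto f atTop atTop)
    (h : ∀ᶠ n : ℕ in atTop, f n * Real.log n ≤ G n) :
    Negligible fun n => Real.exp (-G n) := by
  intro z
  refine squeeze_zero' (Eventually.of_forall fun n => by positivity) ?_
    tendsto_one_div_atTop_nhds_zero_nat
  filter_upwards [h, hf.eventually_ge_atTop (z + 1), eventually_gt_atTop 0] with n hn hfn hn0
  have hn0' : (0 : ℝ) < n := by exact_mod_cast hn0
  have hlog : 0 ≤ Real.log n := Real.log_natCast_nonneg n
  have h1 : Real.exp (-G n) ≤ ((n : ℝ) ^ (z + 1))⁻¹ := by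
    rw [Real.exp_neg]
    refine inv_anti₀ (by positivity) ?_
    rw [← Real.exp_log (pow_pos hn0' (z + 1)), Real.log_pow, Real.exp_le_exp]
    push_cast
    exact le_trans (by gcongr) hn
  calc (n : ℝ) ^ z * Real.exp (-G n) ≤ (n : ℝ) ^ z * ((n : ℝ) ^ (z + 1))⁻¹ := by gcongr
    _ = 1 / n := by rw [pow_succ]; field_simp

/-- A modulus of polynomial size has `o(n)` bits. -/
theorem bitLen_isLittleO {q : ℕ → ℕ} (hq : ∀ n, 1 < q n)
    (hq_poly : ∃ d : ℕ, (fun n : ℕ => (q n : ℝ)) =O[atTop] (fun n : ℕ => (n : ℝ) ^ d)) :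
    (fun n : ℕ => (bitLen (q n) : ℝ)) =o[atTop] (fun n : ℕ => (n : ℝ)) := by
  obtain ⟨d, hd⟩ := hq_poly
  obtain ⟨c, hc, hb⟩ := hd.exists_pos
  have hlog : (fun n : ℕ => (1 + Real.log c / Real.log 2) + d / Real.log 2 * Real.log n)
      =o[atTop] (fun n : ℕ => (n : ℝ)) := by
    have h1 : (fun n : ℕ => Real.log n) =o[atTop] (fun n : ℕ => (n : ℝ)) :=
      Real.isLittleO_log_id_atTop.comp_tendsto tendsto_natCast_atTop_atTop
    refine IsLittleO.add ?_ (h1.const_mul_left _)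
    exact isLittleO_const_left.2 (Or.inr (tendsto_norm_atTop_atTop.comp
      tendsto_natCast_atTop_atTop))
  refine IsBigO.trans_isLittleO (IsBigO.of_bound 1 ?_) hlog
  filter_upwards [hb.bound, eventually_gt_atTop 0] with n hn hn0
  have hn0' : (0 : ℝ) < n := by exact_mod_cast hn0
  rw [Real.norm_of_nonneg (by positivity), Real.norm_of_nonneg (by positivity)] at hn
  have hlt := Nat.pow_pred_clog_lt_self one_lt_two (hq n)
  have hlt' : ((2 : ℝ) ^ (bitLen (q n)).pred) ≤ c * n ^ d := by
    refine le_trans ?_ hn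
    exact_mod_cast hlt.le
  have h2 := Real.log_le_log (by positivity) hlt'
  rw [Real.log_pow, Real.log_mul (by positivity) (by positivity), Real.log_pow] at h2
  have hl2 : 0 < Real.log 2 := Real.log_pos one_lt_two
  have h3 : (bitLen (q n) : ℝ) ≤ (bitLen (q n)).pred + 1 := by
    exact_mod_cast Nat.le_succ_of_pred_le le_rfl
  rw [Real.norm_of_nonneg (by positivity), one_mul]
  refine le_trans ?_ (le_abs_self _)
  have h4 : ((bitLen (q n)).pred : ℝ) ≤ (Real.log c + d * Real.log n) / Real.log 2 := by
    rwa [le_div_iff₀ hl2]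
  calc (bitLen (q n) : ℝ) ≤ _ := h3
    _ ≤ (Real.log c + d * Real.log n) / Real.log 2 + 1 := by linarith
    _ = _ := by ring

theorem eventually_one_le_of_sqrt_log_isLittleO {r : ℕ → ℝ} (hr_pos : ∀ n, 0 < r n)
    (hr_lower : (fun n : ℕ => Real.sqrt (Real.log n)) =o[atTop] r) :
    ∀ᶠ n : ℕ in atTop, 1 ≤ r n := by
  filter_upwards [hr_lower.bound one_pos, eventually_ge_atTop 3] with n hn hn3
  rw [Real.norm_of_nonneg (Real.sqrt_nonneg _), Real.norm_of_nonneg (hr_pos n).le, one_mul] at hn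
  refine le_trans (Real.one_le_sqrt.2 ?_) hn
  rw [Real.le_log_iff_exp_le (by positivity)]
  have : (3 : ℝ) ≤ n := by exact_mod_cast hn3
  linarith [Real.exp_one_lt_d9]

theorem eventually_le_modulus {q : ℕ → ℕ} {r : ℕ → ℝ} (hk : ∀ n, 0 < bitLen (q n))
    (hr : ∀ᶠ n : ℕ in atTop, 1 ≤ r n)
    (hq_large : (fun n : ℕ => ((n * bitLen (q n) : ℕ) : ℝ) ^ (3 / 2 : ℝ) * r n)
      =O[atTop] (fun n : ℕ => (q n : ℝ))) :
    ∀ᶠ n : ℕ in atTop, n ≤ q n := by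
  obtain ⟨c, hc, h⟩ := hq_large.exists_pos
  have hsqrt : Tendsto (fun n : ℕ => √(n : ℝ)) atTop atTop :=
    Real.tendsto_sqrt_atTop.comp tendsto_natCast_atTop_atTop
  filter_upwards [h.bound, hr, hsqrt.eventually_ge_atTop c] with n hn hrn hcn
  rw [Real.norm_of_nonneg (by positivity), Real.norm_of_nonneg (by positivity),
    Real.rpow_three_halves (by positivity)] at hn
  have hnN : √(n : ℝ) ≤ √((n * bitLen (q n) : ℕ) : ℝ) :=
    Real.sqrt_le_sqrt (by exact_mod_cast Nat.le_mul_of_pos_right n (hk n))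
  have h5 : c * n ≤ c * q n := by
    calc c * n ≤ √(n : ℝ) * n := by gcongr
      _ = √(n : ℝ) ^ 3 * 1 := by
        rw [mul_one, pow_succ, Real.sq_sqrt (by positivity), mul_comm]
      _ ≤ √((n * bitLen (q n) : ℕ) : ℝ) ^ 3 * r n := by gcongr
      _ ≤ _ := hn
  exact_mod_cast le_of_mul_le_mul_left h5 hc

/-- The squared deviation `k √n / r` is `ω(log n)`, because `k ≥ log n` and `r = o(√n)`. -/
theorem negligible_exp_neg_deviation {q : ℕ → ℕ} {r : ℕ → ℝ} (hr_pos : ∀ n, 0 < r n)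
    (hr_upper : r =o[atTop] (fun n : ℕ => Real.sqrt n)) (hq : ∀ᶠ n : ℕ in atTop, n ≤ q n) :
    Negligible fun n => Real.exp (-(bitLen (q n) * √n / r n)) := by
  refine negligible_exp_neg (f := fun n => √n / r n) ?_ ?_
  · have h0 : Tendsto (fun n : ℕ => r n / √n) atTop (nhdsWithin 0 (Set.Ioi 0)) := by
      refine tendsto_nhdsWithin_iff.2 ⟨hr_upper.tendsto_div_nhds_zero, ?_⟩
      filter_upwards [eventually_gt_atTop 0] with n hn
      have := hr_pos n
      have : (0 : ℝ) < n := by exact_mod_cast hn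
      rw [Set.mem_Ioi]
      positivity
    refine h0.inv_tendsto_nhdsGT_zero.congr fun n => ?_
    simp
  · filter_upwards [hq, eventually_gt_atTop 0] with n hn hn0
    have hr := hr_pos n
    have hn0' : (0 : ℝ) < n := by exact_mod_cast hn0
    have hlog : Real.log n ≤ bitLen (q n) := by
      rw [Real.log_le_iff_le_exp hn0']
      have h1 : n ≤ 2 ^ bitLen (q n) := hn.trans (Nat.le_pow_clog one_lt_two _)
      calc (n : ℝ) ≤ 2 ^ bitLen (q n) := by exact_mod_cast h1
        _ ≤ Real.exp 1 ^ bitLen (q n) := by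
          gcongr
          linarith [Real.exp_one_gt_d9]
        _ = Real.exp (bitLen (q n)) := by rw [← Real.exp_nat_mul, mul_one]
    calc √n / r n * Real.log n ≤ √n / r n * bitLen (q n) := by gcongr
      _ = _ := by ring

/-- All terms of the failure probability other than the statistical distance are at most of the
order `exp (-G)`, where `G = k √n / r ≤ n k`. -/
theorem failure_terms_le {m c d G N : ℝ} (hc : 0 < c) (hm : m ≤ c * N) (hG0 : 0 ≤ G)
    (hGN : G ≤ N) :
    4 * (m * Real.exp (-Real.pi * √N ^ 2)) + 4 * d + 3 * Real.exp (-((c + 1) * N)) +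
      6 * Real.exp (-Real.pi * √G ^ 2) ≤ 4 * d + (4 * c + 9) * Real.exp (-G) := by
  have hN0 : 0 ≤ N := hG0.trans hGN
  rw [Real.sq_sqrt hN0, Real.sq_sqrt hG0]
  have hpi := Real.pi_gt_three
  have h1 : m * Real.exp (-Real.pi * N) ≤ c * Real.exp (-G) := by
    have h2 : N ≤ Real.exp N := by linarith [Real.add_one_le_exp N]
    have h3 : N * Real.exp (-Real.pi * N) ≤ Real.exp (-G) := by
      calc N * Real.exp (-Real.pi * N) ≤ Real.exp N * Real.exp (-Real.pi * N) := by gcongr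
        _ = Real.exp (N + -Real.pi * N) := (Real.exp_add _ _).symm
        _ ≤ _ := Real.exp_le_exp.2 (by nlinarith)
    calc m * Real.exp (-Real.pi * N) ≤ c * N * Real.exp (-Real.pi * N) := by gcongr
      _ = c * (N * Real.exp (-Real.pi * N)) := by ring
      _ ≤ _ := by gcongr
  have h2 : Real.exp (-((c + 1) * N)) ≤ Real.exp (-G) := Real.exp_le_exp.2 (by nlinarith)
  have h3 : Real.exp (-Real.pi * G) ≤ Real.exp (-G) := Real.exp_le_exp.2 (by nlinarith)
  linarith

/-! ### Single-hop correctness -/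

theorem mainTheorem4 (q mbar l : ℕ → ℕ) [∀ n, NeZero (q n)] (r s α : ℕ → ℝ)
    (hr_pos : ∀ n, 0 < r n) (hs_pos : ∀ n, 0 < s n) (hα_pos : ∀ n, 0 < α n)
    -- `r = ω(√(log n))`, and `r = o(√n)`
    (hr_lower : (fun n : ℕ => Real.sqrt (Real.log n)) =o[atTop] r)
    (hr_upper : r =o[atTop] (fun n : ℕ => Real.sqrt n))
    -- `q = poly(n)` is a prime power, large enough: `q = Ω((nk)^(3/2) r)`
    (hq_prime_pow : ∀ n, IsPrimePow (q n))
    (hq_poly : ∃ d : ℕ, (fun n : ℕ => (q n : ℝ)) =O[atTop] (fun n : ℕ => (n : ℝ) ^ d))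
    (hq_large : (fun n : ℕ => ((n * bitLen (q n) : ℕ) : ℝ) ^ (3 / 2 : ℝ) * r n)
      =O[atTop] (fun n : ℕ => (q n : ℝ)))
    -- `mbar = O(nk)`, such that `(Ā, Ā R)` is negligibly far from uniform
    (hmbar : (fun n : ℕ => (mbar n : ℝ)) =O[atTop] (fun n : ℕ => ((n * bitLen (q n) : ℕ) : ℝ)))
    (hunif : Negligible (fun n : ℕ =>
      Adaptive.trapdoorDist ⟨n, q n, mbar n, l n, r n, s n, α n⟩))
    -- `s = O(√(nk)) r²`
    (hs : s =O[atTop] (fun n : ℕ => Real.sqrt ((n * bitLen (q n) : ℕ) : ℝ) * r n ^ 2))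
    -- `1/α` is of order at least `(nk)² r²`
    (hα : (fun n : ℕ => ((n * bitLen (q n) : ℕ) : ℝ) ^ 2 * r n ^ 2)
      =O[atTop] (fun n : ℕ => 1 / α n)) :
    SingleHopCorrect
      (fun n => Adaptive.scheme ⟨n, q n, mbar n, l n, r n, s n, α n⟩) := by
  obtain ⟨C, hC, hCtail⟩ := exists_gaussNormTail
  obtain ⟨c₁, hc₁, h₁⟩ := hmbar.exists_pos
  obtain ⟨c₂, hc₂, h₂⟩ := hs.exists_pos
  obtain ⟨c₃, hc₃, h₃⟩ := hα.exists_pos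
  obtain ⟨c₄, hc₄, h₄⟩ := hq_large.exists_pos
  have hq1 : ∀ n, 1 < q n := fun n => (hq_prime_pow n).one_lt
  have hk1 : ∀ n, 0 < bitLen (q n) := fun n => Nat.clog_pos one_lt_two (hq1 n)
  set A : ℝ := c₃ * (1 + √(4 * c₁ + C * c₂ ^ 2 * (c₁ + 1) + 1) +
      √(4 * c₁ + C * c₂ ^ 2 * (c₁ + 1) + 1) * √((C + 1) * (c₁ + 1))) with hA
  have hA0 : 0 < A := by positivity
  set B : ℝ := √C * (c₁ + 1) * c₄ with hB
  have hB0 : 0 < B := by positivity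
  set η : ℝ := (1 / (16 * A)) ^ 2 with hη
  set η' : ℝ := 1 / (16 * B) with hη'
  have hηA : 16 * (A * √η) ≤ 1 := by
    rw [hη, Real.sqrt_sq (by positivity)]
    refine le_of_eq ?_
    field_simp
  have hηB : 16 * (√C * (c₁ + 1) * η' * c₄) ≤ 1 := by
    refine le_of_eq ?_
    rw [show √C * (c₁ + 1) * η' * c₄ = B * η' by rw [hB]; ring, hη']
    field_simp
  let G : ℕ → ℝ := fun n => bitLen (q n) * √n / r n
  let td : ℕ → ℝ := fun n => Adaptive.trapdoorDist ⟨n, q n, mbar n, l n, r n, s n, α n⟩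
  have hr1 := eventually_one_le_of_sqrt_log_isLittleO hr_pos hr_lower
  have hqn := eventually_le_modulus hk1 hr1 hq_large
  let δ : ℕ → ℝ := fun n => 4 * td n + (4 * c₁ + 9) * Real.exp (-G n)
  have hmain : ∀ᶠ n : ℕ in atTop,
      (∀ (id : Fin (l n) → ℤˣ) (b : Bool), 1 - δ n ≤ ((Adaptive.scheme
        ⟨n, q n, mbar n, l n, r n, s n, α n⟩).encDec id b (some b)).toReal) ∧
      (∀ (idi idj : Fin (l n) → ℤˣ) (b : Bool), 1 - δ n ≤ ((Adaptive.scheme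
        ⟨n, q n, mbar n, l n, r n, s n, α n⟩).encReEncDec idi idj b (some b)).toReal) := by
    filter_upwards [h₁.bound, h₂.bound, h₃.bound, h₄.bound, hr1, hqn, eventually_ge_atTop 8,
      hr_upper.bound (show 0 < η by positivity),
      (bitLen_isLittleO hq1 hq_poly).bound (show 0 < η' ^ 2 by positivity)]
      with n h1 h2 h3 h4 hrn hqn hn8 h5 h6
    have hr0 := hr_pos n
    have hs0 := hs_pos n
    have hα0 := hα_pos n
    set N : ℝ := ((n * bitLen (q n) : ℕ) : ℝ) with hN
    have hn1 : (1 : ℝ) ≤ n := by exact_mod_cast (by omega : 1 ≤ n)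
    have hN0 : 0 ≤ N := by positivity
    rw [Real.norm_of_nonneg (by positivity), Real.norm_of_nonneg (by positivity)]
      at h1 h2 h3 h4 h5 h6
    rw [Real.rpow_three_halves hN0] at h4
    rw [mul_one_div, le_div_iff₀ hα0] at h3
    let P : Adaptive.Params := ⟨n, q n, mbar n, l n, r n, s n, α n⟩
    obtain ⟨T, T', hb⟩ := Adaptive.noiseBounds_of_le (P := P) hC hc₁
      (show 0 < η by positivity) (show 0 < η' by positivity) (by change 0 < n; omega) (hk1 n) hN hrn
      hs0 hα0 (hn8.trans hqn) h1 h2 h3 h4 h5 h6 hηA hηB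
    refine hb.correct hC hCtail ?_
    refine failure_terms_le hc₁ h1 (by positivity) ?_
    rw [div_le_iff₀ hr0]
    calc bitLen (q n) * √n ≤ bitLen (q n) * (n * r n) := by
          gcongr
          calc √(n : ℝ) ≤ n := Real.sqrt_le_iff.2 ⟨by positivity, by nlinarith⟩
            _ ≤ n * r n := le_mul_of_one_le_right (by positivity) hrn
      _ = N * r n := by rw [hN]; push_cast; ring
  obtain ⟨n₀, hn₀⟩ := eventually_atTop.1 hmain
  -- for small `n` the bound `1` makes the claim trivial
  refine ⟨fun n => if n₀ ≤ n then δ n else 1, ?_, ?_⟩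
  · have hG' := negligible_exp_neg_deviation hr_pos hr_upper hqn
    refine SuperpolynomialDecay.congr' ((hunif.const_mul 4).add (hG'.const_mul (4 * c₁ + 9))) ?_
    filter_upwards [eventually_ge_atTop n₀] with n hn
    rw [if_pos hn]
    rfl
  · intro n
    by_cases hn : n₀ ≤ n
    · simp only [if_pos hn]
      exact hn₀ n hn
    · simp [if_neg hn]
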